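/- Theorem (Nonamalgamation, Woodin). Let $W$ be a countable transitive model of ZFC. View Cohen forcing as the partial order $2^{<\omega}$ of finite binary sequences, ordered by end-extension. Call $c\in 2^\omega$ a \emph{$W$-generic Cohen real} if the set $G_c$ of its finite initial segments is a $W$-generic filter on $2^{<\omega}$ (a filter that meets every dense $D\subseteq 2^{<\omega}$ with $D\in W$), and let $W[c]=W[G_c]$ be the corresponding forcing extension, that is, the set of values under $G_c$ of the $2^{<\omega}$-names in $W$. Then there are $W$-generic Cohen reals $c$ and $d$ such that the forcing extensions $W[c]$ and $W[d]$ have no common extension to a model of set theory with the same ordinals: there is no model $(U,E)$ of ZFC, transitive or not, such that $(U,E)$ extends both $(W[c],\in)$ and $(W[d],\in)$ (that is, $W[c]\cup W[d]\subseteq U$, and $E$ agrees with $\in$ on $W[c]$ and on $W[d]$) and such that the ordinals of $(U,E)$, together with their order, are exactly the ordinals of $W$. -/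

import Mathlib

universe u

namespace Nonamalgamation

/-! ### Models of ZFC -/

/-- The relation symbols of the language of set theory: a single binary one. -/
inductive SetRel : ℕ → Type
  | mem : SetRel 2

/-- The first-order language of set theory `{∈}`. -/
def setLang : FirstOrder.Language.{0, 0} := ⟨fun _ => Empty, SetRel⟩

/-- A binary relation `E` on `M`, regarded as an interpretation of `∈`. -/
@[reducible] def memStructure {M : Type*} (E : M → M → Prop) : setLang.Structure M where
  funMap := fun f _ => Empty.elim f
  RelMap := fun r v => match r, v with
    | SetRel.mem, v => E (v 0) (v 1)

/-- `(M, E) ⊨ φ[a]` for the `n`-tuple `a` substituted for the free variables of a first-order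
formula `φ` of set theory with parameters from `M`. -/
def Holds {M : Type*} (E : M → M → Prop) {n : ℕ} (φ : setLang.Formula (M ⊕ Fin n))
    (a : Fin n → M) : Prop :=
  @FirstOrder.Language.Formula.Realize setLang M (memStructure E) (M ⊕ Fin n) φ (Sum.elim id a)

/-- `(M, E)` is a model of ZFC. Each field says that `(M, E)` satisfies one axiom, or, for
separation and replacement, every first-order instance of the axiom scheme. -/
structure IsModelZFC {M : Type*} (E : M → M → Prop) : Prop where
  extensionality : ∀ x y, (∀ z, E z x ↔ E z y) → x = y
  foundation : ∀ x, (∃ y, E y x) → ∃ y, E y x ∧ ∀ z, E z x → ¬ E z y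
  pairing : ∀ x y, ∃ z, ∀ w, E w z ↔ w = x ∨ w = y
  union : ∀ x, ∃ u, ∀ z, E z u ↔ ∃ y, E y x ∧ E z y
  powerset : ∀ x, ∃ p, ∀ z, E z p ↔ ∀ w, E w z → E w x
  infinity : ∃ w, (∃ e, E e w ∧ ∀ z, ¬ E z e) ∧
    ∀ x, E x w → ∃ y, E y w ∧ ∀ z, E z y ↔ E z x ∨ z = x
  separation : ∀ (φ : setLang.Formula (M ⊕ Fin 1)) (a : M),
    ∃ b, ∀ x, E x b ↔ E x a ∧ Holds E φ ![x]
  replacement : ∀ (φ : setLang.Formula (M ⊕ Fin 2)),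
    (∀ x y z, Holds E φ ![x, y] → Holds E φ ![x, z] → y = z) →
    ∀ a, ∃ b, ∀ y, E y b ↔ ∃ x, E x a ∧ Holds E φ ![x, y]
  /-- Every set of nonempty, pairwise disjoint sets has a transversal. -/
  choice : ∀ x, (∀ y, E y x → ∃ z, E z y) →
    (∀ y y', E y x → E y' x → (∃ z, E z y ∧ E z y') → y = y') →
    ∃ t, ∀ y, E y x → ∃! z, E z y ∧ E z t

/-- `(M, E) ⊨ "x is an ordinal"`: `x` is a transitive set of transitive sets. -/
def IsOrdIn {M : Type*} (E : M → M → Prop) (x : M) : Prop :=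
  (∀ y z, E y z → E z x → E y x) ∧ ∀ y z w, E y z → E z w → E w x → E y w

/-- The true membership relation on the elements of a set `W`. -/
def memOn (W : ZFSet.{u}) : {x // x ∈ W} → {x // x ∈ W} → Prop := fun x y => x.1 ∈ y.1

/-- `W` is a countable transitive model of ZFC. -/
structure IsCTM (W : ZFSet.{u}) : Prop where
  countable : (W : Set ZFSet.{u}).Countable
  transitive : W.IsTransitive
  zfc : IsModelZFC (memOn W)

/-! ### Forcing extensions -/

/-- `G` is a `W`-generic filter on the partial order `P`, ordered by `le`
(`le p q` says that `p` is the stronger condition). -/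
structure IsGenericFilter (W P : ZFSet.{u}) (le : ZFSet.{u} → ZFSet.{u} → Prop)
    (G : ZFSet.{u}) : Prop where
  subset : ∀ p ∈ G, p ∈ P
  nonempty : ∃ p, p ∈ G
  upward : ∀ p ∈ G, ∀ q ∈ P, le p q → q ∈ G
  directed : ∀ p ∈ G, ∀ q ∈ G, ∃ r ∈ G, le r p ∧ le r q
  generic : ∀ D ∈ W, (∀ p ∈ D, p ∈ P) → (∀ p ∈ P, ∃ q ∈ D, le q p) → ∃ p ∈ G, p ∈ D

/-- `τ` is a `P`-name: a set of pairs `(σ, p)` with `σ` a `P`-name and `p ∈ P`. -/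
inductive IsName (P : ZFSet.{u}) : ZFSet.{u} → Prop
  | mk (τ : ZFSet.{u}) (h₁ : ∀ x ∈ τ, ∃ σ, ∃ p ∈ P, x = ZFSet.pair σ p)
      (h₂ : ∀ σ p, ZFSet.pair σ p ∈ τ → IsName P σ) : IsName P τ

theorem rank_lt_of_pair_mem {σ p τ : ZFSet.{u}} (h : ZFSet.pair σ p ∈ τ) : σ.rank < τ.rank := by
  have h₁ : σ ∈ ({σ} : ZFSet.{u}) := by simp
  have h₂ : ({σ} : ZFSet.{u}) ∈ ZFSet.pair σ p := by simp [ZFSet.pair]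
  exact (ZFSet.rank_lt_of_mem h₁).trans
    ((ZFSet.rank_lt_of_mem h₂).trans (ZFSet.rank_lt_of_mem h))

instance small_pair_mem (G τ : ZFSet.{u}) :
    Small.{u} {σ : ZFSet.{u} // ∃ p ∈ G, ZFSet.pair σ p ∈ τ} := by
  have key : {σ : ZFSet.{u} | ∃ p ∈ G, ZFSet.pair σ p ∈ τ} ⊆
      ((ZFSet.sUnion (ZFSet.sUnion τ) : ZFSet.{u}) : Set ZFSet.{u}) := by
    rintro σ ⟨p, -, h⟩
    refine ZFSet.mem_sUnion.2 ⟨{σ}, ZFSet.mem_sUnion.2 ⟨_, h, ?_⟩, ?_⟩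
    · simp [ZFSet.pair]
    · simp
  have : Small.{u} ((ZFSet.sUnion (ZFSet.sUnion τ) : ZFSet.{u}) : Set ZFSet.{u}) :=
    ZFSet.small_coe _
  exact small_subset key

/-- The value of the name `τ` under the filter `G`:
`val G τ = {val G σ | ∃ p ∈ G, (σ, p) ∈ τ}`. -/
noncomputable def val (G τ : ZFSet.{u}) : ZFSet.{u} :=
  ZFSet.range fun σ : {σ : ZFSet.{u} // ∃ p ∈ G, ZFSet.pair σ p ∈ τ} => val G σ.1
termination_by τ.rank
decreasing_by
  obtain ⟨p, -, h⟩ := σ.2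
  exact rank_lt_of_pair_mem h

theorem mem_val {G τ x : ZFSet.{u}} :
    x ∈ val G τ ↔ ∃ σ, ∃ p ∈ G, ZFSet.pair σ p ∈ τ ∧ val G σ = x := by
  rw [val, ZFSet.mem_range]
  constructor
  · rintro ⟨⟨σ, p, hp, h⟩, hx⟩
    exact ⟨σ, p, hp, h, hx⟩
  · rintro ⟨σ, p, hp, h, hx⟩
    exact ⟨⟨σ, p, hp, h⟩, hx⟩

/-- The forcing extension `W[G]`: the values under `G` of the `P`-names in `W`. -/
def genericExtension (W P G : ZFSet.{u}) : Set ZFSet.{u} :=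
  {x | ∃ τ ∈ W, IsName P τ ∧ val G τ = x}

/-! ### Cohen reals -/

/-- The set `2 = {0, 1}`. -/
def two : ZFSet.{u} := {∅, {∅}}

/-- Cohen forcing `2^{<ω}`: the finite binary sequences, i.e. the functions `n → 2` with `n ∈ ω`. -/
def cohenPoset : ZFSet.{u} :=
  ZFSet.sep (fun p => ∃ n ∈ ZFSet.omega, ZFSet.IsFunc n two p)
    (ZFSet.powerset (ZFSet.prod ZFSet.omega two))

/-- The order of Cohen forcing: `p` is stronger than `q` when it extends `q` as a sequence. -/
def cohenLE (p q : ZFSet.{u}) : Prop := q ⊆ p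

/-- The filter of the finite initial segments of a real `c : ω → 2`. -/
def cohenFilter (c : ZFSet.{u}) : ZFSet.{u} := ZFSet.sep (fun p => p ⊆ c) cohenPoset

/-- `c : ω → 2` is a `W`-generic Cohen real. -/
def IsCohenReal (W c : ZFSet.{u}) : Prop :=
  ZFSet.IsFunc ZFSet.omega two c ∧ IsGenericFilter W cohenPoset cohenLE (cohenFilter c)

/-- The forcing extension `W[c]` for a `W`-generic Cohen real `c`. -/
def cohenExtension (W c : ZFSet.{u}) : Set ZFSet.{u} :=
  genericExtension W cohenPoset (cohenFilter c)

/-! ### Extensions with the same ordinals -/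

/-- The structure `(U, E)` extends `(N, ∈)`: `N ⊆ U`, and `E` agrees with `∈` on `N`. -/
def Extends {U : ZFSet.{u}} (E : {x // x ∈ U} → {x // x ∈ U} → Prop) (N : Set ZFSet.{u}) : Prop :=
  (∀ x ∈ N, x ∈ U) ∧ ∀ x y : {x // x ∈ U}, x.1 ∈ N → y.1 ∈ N → (E x y ↔ x.1 ∈ y.1)

/-- `(U, E)` has the same ordinals as the transitive model `(W, ∈)`: the same sets are ordinals
in both, and they are ordered in the same way. -/
def SameOrdinals {U : ZFSet.{u}} (E : {x // x ∈ U} → {x // x ∈ U} → Prop) (W : ZFSet.{u}) : Prop :=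
  (∀ x, (∃ h : x ∈ U, IsOrdIn E ⟨x, h⟩) ↔ x ∈ W ∧ x.IsOrdinal) ∧
    ∀ x y : {x // x ∈ U}, IsOrdIn E x → IsOrdIn E y → (E x y ↔ x.1 ∈ y.1)

end Nonamalgamation

/-! The ordinals of $W$ are countable from outside. Fix an enumeration $g$ of them by the natural
numbers, and let the real $z$ record, along an enumeration of $\omega\times\omega$, for which pairs
$g(m)\in g(n)$. A model of ZFC with exactly the ordinals of $W$ cannot define $z$: by collapsing the
coded relation it would recover $g$, and replacement would give it a set of all its ordinals,
against Burali-Forti (`SameOrdinals.not_isDefinable_code`).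

Yet $z$ is the sum modulo 2 of two reals, each of which is harmless alone. Each dense set in $W$
determines a dense open subset of Cantor space, there are countably many of them, and translation by
$z$ is a homeomorphism; so by Baire some $b$ has both $b$ and $b+z$ generic
(`exists_isCohenReal_xor`). A common extension of $W[b]$ and $W[b+z]$ compares the two reals place
by place and so defines $z$.

Since $(U,E)$ may be ill-founded, only its ordinals are under control. They include $\omega$, so its
natural numbers are standard (`SameOrdinals.isStandardOmega`), and its internal recursions can be
verified by external induction (`isDefinable_sequence`, `isDefinable_collapse`). From forcing one
needs only a name in $W$ that records the Cohen real (`IsCTM.exists_mem_cohenExtension`); neither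
the forcing theorem nor ZFC in the extensions plays a role. -/

namespace Nonamalgamation

/-! ### Definable relations -/

section Definability

universe v

variable {M : Type v} {E : M → M → Prop} {α β : Type}

/-- A function of the free variables that is either a variable or a parameter. -/
class IsTerm (f : (α → M) → M) : Prop where
  out : ∃ t : M ⊕ α, ∀ a, f a = Sum.elim id a t

/-- A relation on tuples that is first-order definable with parameters in `(M, E)`. -/
class IsDefinable (E : M → M → Prop) (R : (α → M) → Prop) : Prop where
  out : ∃ φ : setLang.Formula (M ⊕ α), ∀ a : α → M,
    @FirstOrder.Language.Formula.Realize setLang M (memStructure E) _ φ (Sum.elim id a) ↔ R a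

instance isTerm_var (i : α) : IsTerm (fun a : α → M => a i) := ⟨.inr i, fun _ => rfl⟩

instance isTerm_const (m : M) : IsTerm (fun _ : α → M => m) := ⟨.inl m, fun _ => rfl⟩

/-- Carries a term under a quantifier: in `Option α` the bound variable is `none` and the older
variables sit under `some`. This lets instance search prove definability by the shape of a
statement. -/
instance isTerm_lift (f : (α → M) → M) [h : IsTerm f] :
    IsTerm (fun b : Option α → M => f fun i => b (some i)) := by
  obtain ⟨t, ht⟩ := h.out
  refine ⟨t.map id some, fun a => ?_⟩
  rw [ht]
  cases t <;> rfl

instance isDefinable_mem (f g : (α → M) → M) [hf : IsTerm f] [hg : IsTerm g] :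
    IsDefinable E (fun a => E (f a) (g a)) := by
  obtain ⟨s, hs⟩ := hf.out
  obtain ⟨t, ht⟩ := hg.out
  let _ := memStructure E
  let r : setLang.Relations 2 := SetRel.mem
  refine ⟨r.formula₂ (.var s) (.var t), fun a => ?_⟩
  rw [FirstOrder.Language.Formula.realize_rel₂, hs, ht]
  rfl

instance isDefinable_eq (f g : (α → M) → M) [hf : IsTerm f] [hg : IsTerm g] :
    IsDefinable E (fun a => f a = g a) := by
  obtain ⟨s, hs⟩ := hf.out
  obtain ⟨t, ht⟩ := hg.out
  let _ := memStructure E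
  refine ⟨(FirstOrder.Language.Term.var s).equal (.var t), fun a => ?_⟩
  rw [FirstOrder.Language.Formula.realize_equal, hs, ht]
  rfl

instance isDefinable_not (R : (α → M) → Prop) [h : IsDefinable E R] :
    IsDefinable E (fun a => ¬ R a) := by
  obtain ⟨φ, hφ⟩ := h.out
  let _ := memStructure E
  exact ⟨φ.not, fun a => by rw [FirstOrder.Language.Formula.realize_not, hφ]⟩

instance isDefinable_imp (R S : (α → M) → Prop) [h : IsDefinable E R] [k : IsDefinable E S] :
    IsDefinable E (fun a => R a → S a) := by
  obtain ⟨φ, hφ⟩ := h.out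
  obtain ⟨ψ, hψ⟩ := k.out
  let _ := memStructure E
  exact ⟨φ.imp ψ, fun a => by rw [FirstOrder.Language.Formula.realize_imp, hφ, hψ]⟩

instance isDefinable_and (R S : (α → M) → Prop) [h : IsDefinable E R] [k : IsDefinable E S] :
    IsDefinable E (fun a => R a ∧ S a) := by
  obtain ⟨φ, hφ⟩ := h.out
  obtain ⟨ψ, hψ⟩ := k.out
  let _ := memStructure E
  exact ⟨φ ⊓ ψ, fun a => by rw [FirstOrder.Language.Formula.realize_inf, hφ, hψ]⟩

instance isDefinable_or (R S : (α → M) → Prop) [h : IsDefinable E R] [k : IsDefinable E S] :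
    IsDefinable E (fun a => R a ∨ S a) := by
  obtain ⟨φ, hφ⟩ := h.out
  obtain ⟨ψ, hψ⟩ := k.out
  let _ := memStructure E
  exact ⟨φ ⊔ ψ, fun a => by rw [FirstOrder.Language.Formula.realize_sup, hφ, hψ]⟩

instance isDefinable_iff (R S : (α → M) → Prop) [h : IsDefinable E R] [k : IsDefinable E S] :
    IsDefinable E (fun a => R a ↔ S a) := by
  obtain ⟨φ, hφ⟩ := h.out
  obtain ⟨ψ, hψ⟩ := k.out
  let _ := memStructure E
  exact ⟨φ.iff ψ, fun a => by rw [FirstOrder.Language.Formula.realize_iff, hφ, hψ]⟩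

instance isDefinable_exists (R : (α → M) → M → Prop)
    [h : IsDefinable E (fun b : Option α → M => R (fun i => b (some i)) (b none))] :
    IsDefinable E (fun a => ∃ x, R a x) := by
  obtain ⟨φ, hφ⟩ := h.out
  let _ := memStructure E
  let g : M ⊕ Option α → (M ⊕ α) ⊕ Unit :=
    Sum.elim (fun m => .inl (.inl m)) fun o => o.elim (.inr ()) fun i => .inl (.inr i)
  refine ⟨(φ.relabel g).iExs Unit, fun a => ?_⟩
  rw [FirstOrder.Language.Formula.realize_iExs]
  have key : ∀ x : Unit → M, (φ.relabel g).Realize (Sum.elim (Sum.elim id a) x) ↔ R a (x ()) := by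
    intro x
    refine FirstOrder.Language.Formula.realize_relabel.trans
      (Iff.trans (iff_of_eq ?_) (hφ fun o => o.elim (x ()) a))
    congr 1
    funext y
    rcases y with m | _ | i <;> rfl
  exact ⟨fun ⟨x, hx⟩ => ⟨_, (key x).1 hx⟩, fun ⟨x, hx⟩ => ⟨fun _ => x, (key _).2 hx⟩⟩

theorem IsDefinable.congr {R S : (α → M) → Prop} (h : IsDefinable E R) (hRS : ∀ a, R a ↔ S a) :
    IsDefinable E S := by
  rwa [show S = R from funext fun a => propext (hRS a).symm]

instance isDefinable_forall (R : (α → M) → M → Prop)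
    [IsDefinable E (fun b : Option α → M => R (fun i => b (some i)) (b none))] :
    IsDefinable E (fun a => ∀ x, R a x) :=
  (inferInstance : IsDefinable E (fun a => ¬ ∃ x, ¬ R a x)).congr fun a => by simp

/-- Substitution of terms for the free variables of a definable relation. -/
theorem IsDefinable.subst {R : (β → M) → Prop} (h : IsDefinable E R) (f : β → (α → M) → M)
    (hf : ∀ i, IsTerm (f i)) : IsDefinable E (fun a => R fun i => f i a) := by
  obtain ⟨φ, hφ⟩ := h.out
  choose t ht using fun i => (hf i).out
  let _ := memStructure E
  refine ⟨φ.relabel (Sum.elim .inl t), fun a => ?_⟩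
  rw [FirstOrder.Language.Formula.realize_relabel, ← hφ]
  apply iff_of_eq
  congr 1
  funext y
  rcases y with m | i
  · rfl
  · exact (ht i a).symm

theorem IsDefinable.subst_two {R : M → M → Prop}
    (h : IsDefinable E (fun a : Fin 2 → M => R (a 0) (a 1)))
    (f g : (α → M) → M) [hf : IsTerm f] [hg : IsTerm g] :
    IsDefinable E (fun a => R (f a) (g a)) :=
  h.subst ![f, g] fun i => by fin_cases i <;> assumption

/-! ### Basic notions inside a model -/

/-- `(M, E) ⊨ "x is empty"`. -/
def IsEmptyIn (E : M → M → Prop) (x : M) : Prop := ∀ z, ¬ E z x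

/-- `(M, E) ⊨ "y = x ∪ {w}"`. -/
def IsInsertIn (E : M → M → Prop) (w x y : M) : Prop := ∀ z, E z y ↔ E z x ∨ z = w

/-- `(M, E) ⊨ "z = {x, y}"`. -/
def IsUpairIn (E : M → M → Prop) (x y z : M) : Prop := ∀ w, E w z ↔ w = x ∨ w = y

/-- `(M, E) ⊨ "p = (x, y)"` for Kuratowski pairs. -/
def IsPairIn (E : M → M → Prop) (x y p : M) : Prop :=
  ∀ w, E w p ↔ IsUpairIn E x x w ∨ IsUpairIn E x y w

/-- `(M, E) ⊨ "(x, y) ∈ f"`. -/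
def PairMem (E : M → M → Prop) (x y f : M) : Prop := ∃ p, E p f ∧ IsPairIn E x y p

instance isDefinable_isEmptyIn (f : (α → M) → M) [IsTerm f] :
    IsDefinable E (fun a => IsEmptyIn E (f a)) := by
  unfold IsEmptyIn; infer_instance

instance isDefinable_isInsertIn (f g h : (α → M) → M) [IsTerm f] [IsTerm g] [IsTerm h] :
    IsDefinable E (fun a => IsInsertIn E (f a) (g a) (h a)) := by
  unfold IsInsertIn; infer_instance

instance isDefinable_isUpairIn (f g h : (α → M) → M) [IsTerm f] [IsTerm g] [IsTerm h] :
    IsDefinable E (fun a => IsUpairIn E (f a) (g a) (h a)) := by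
  unfold IsUpairIn; infer_instance

instance isDefinable_isPairIn (f g h : (α → M) → M) [IsTerm f] [IsTerm g] [IsTerm h] :
    IsDefinable E (fun a => IsPairIn E (f a) (g a) (h a)) := by
  unfold IsPairIn; infer_instance

instance isDefinable_pairMem (f g h : (α → M) → M) [IsTerm f] [IsTerm g] [IsTerm h] :
    IsDefinable E (fun a => PairMem E (f a) (g a) (h a)) := by
  unfold PairMem; infer_instance

end Definability

/-! ### Elementary set theory inside an arbitrary model of ZFC -/

section Models

universe v

variable {M : Type v} {E : M → M → Prop}

namespace IsModelZFC

theorem exists_sep (H : IsModelZFC E) {R : M → Prop}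
    (hR : IsDefinable E (fun a : Fin 1 → M => R (a 0))) (a : M) :
    ∃ b, ∀ x, E x b ↔ E x a ∧ R x := by
  obtain ⟨φ, hφ⟩ := hR.out
  obtain ⟨b, hb⟩ := H.separation φ a
  exact ⟨b, fun x => (hb x).trans (and_congr_right' (hφ ![x]))⟩

theorem exists_image (H : IsModelZFC E) {R : M → M → Prop}
    (hR : IsDefinable E (fun a : Fin 2 → M => R (a 0) (a 1)))
    (hfun : ∀ x y z, R x y → R x z → y = z) (a : M) :
    ∃ b, ∀ y, E y b ↔ ∃ x, E x a ∧ R x y := by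
  obtain ⟨φ, hφ⟩ := hR.out
  have key : ∀ x y, Holds E φ ![x, y] ↔ R x y := fun x y => hφ ![x, y]
  obtain ⟨b, hb⟩ := H.replacement φ
    (fun x y z h₁ h₂ => hfun x y z ((key x y).1 h₁) ((key x z).1 h₂)) a
  exact ⟨b, fun y => (hb y).trans (exists_congr fun x => and_congr_right' (key x y))⟩

theorem exists_pair (H : IsModelZFC E) (x y : M) : ∃ p, IsPairIn E x y p := by
  obtain ⟨s, hs⟩ := H.pairing x x
  obtain ⟨t, ht⟩ := H.pairing x y
  obtain ⟨p, hp⟩ := H.pairing s t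
  refine ⟨p, fun w => (hp w).trans (or_congr ⟨?_, fun h => ?_⟩ ⟨?_, fun h => ?_⟩)⟩
  · rintro rfl; exact hs
  · exact H.extensionality _ _ fun z => (h z).trans (hs z).symm
  · rintro rfl; exact ht
  · exact H.extensionality _ _ fun z => (h z).trans (ht z).symm

theorem pair_unique (H : IsModelZFC E) {x y p q : M} (hp : IsPairIn E x y p)
    (hq : IsPairIn E x y q) : p = q :=
  H.extensionality _ _ fun z => (hp z).trans (hq z).symm

theorem pair_injective (H : IsModelZFC E) {x y x' y' p : M} (hp : IsPairIn E x y p)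
    (hq : IsPairIn E x' y' p) : x = x' ∧ y = y' := by
  obtain ⟨s, hs⟩ := H.pairing x x
  obtain ⟨t, ht⟩ := H.pairing x y
  obtain ⟨t', ht'⟩ := H.pairing x' y'
  have h₁ := (hq s).1 ((hp s).2 (.inl hs))
  have h₂ := (hq t).1 ((hp t).2 (.inr ht))
  have h₃ := (hp t').1 ((hq t').2 (.inr ht'))
  simp only [IsUpairIn] at *
  have hx : x = x' := by
    have h := hs x'
    rcases h₁ with h₁ | h₁ <;> grind
  subst hx
  have k₁ := ht y
  have k₂ := ht' y'
  refine ⟨rfl, ?_⟩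
  rcases h₂ with h₂ | h₂ <;> rcases h₃ with h₃ | h₃ <;> grind

theorem exists_insert (H : IsModelZFC E) (w x : M) : ∃ y, IsInsertIn E w x y := by
  obtain ⟨s, hs⟩ := H.pairing w w
  obtain ⟨t, ht⟩ := H.pairing x s
  obtain ⟨y, hy⟩ := H.union t
  refine ⟨y, fun z => (hy z).trans ⟨?_, ?_⟩⟩
  · rintro ⟨v, hv, hz⟩
    rcases (ht v).1 hv with rfl | rfl
    · exact .inl hz
    · exact .inr (by simpa using (hs z).1 hz)
  · rintro (h | rfl)
    · exact ⟨x, (ht x).2 (.inl rfl), h⟩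
    · exact ⟨s, (ht s).2 (.inr rfl), (hs z).2 (.inl rfl)⟩

theorem exists_empty (H : IsModelZFC E) : ∃ x, IsEmptyIn E x := by
  obtain ⟨_, ⟨e, _, he⟩, _⟩ := H.infinity
  exact ⟨e, he⟩

theorem insert_unique (H : IsModelZFC E) {w x y z : M} (hy : IsInsertIn E w x y)
    (hz : IsInsertIn E w x z) : y = z :=
  H.extensionality _ _ fun v => (hy v).trans (hz v).symm

theorem pairMem_iff (H : IsModelZFC E) {x y p f : M} (hp : IsPairIn E x y p) :
    PairMem E x y f ↔ E p f :=
  ⟨fun ⟨_, hq, hqp⟩ => H.pair_unique hp hqp ▸ hq, fun h => ⟨p, h, hp⟩⟩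

theorem pairMem_insert (H : IsModelZFC E) {x y p f g : M} (hp : IsPairIn E x y p)
    (hg : IsInsertIn E p f g) (x' y' : M) :
    PairMem E x' y' g ↔ PairMem E x' y' f ∨ x' = x ∧ y' = y := by
  obtain ⟨q, hq⟩ := H.exists_pair x' y'
  rw [H.pairMem_iff hq, H.pairMem_iff hq, hg q]
  refine or_congr_right ⟨?_, ?_⟩
  · rintro rfl
    exact H.pair_injective hq hp
  · rintro ⟨rfl, rfl⟩
    exact H.pair_unique hq hp

end IsModelZFC

/-- `o` is the set of natural numbers of `(M, E)`, all of which are standard: `N n` is the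
`n`-th of them. -/
structure IsStandardOmega (E : M → M → Prop) (N : ℕ → M) (o : M) : Prop where
  mem_omega : ∀ x, E x o ↔ ∃ n, x = N n
  mem_nat : ∀ x n, E x (N n) ↔ ∃ m < n, x = N m
  injective : Function.Injective N

namespace IsStandardOmega

variable {N : ℕ → M} {o : M}

theorem isEmptyIn_iff (S : IsStandardOmega E N o) {n : ℕ} : IsEmptyIn E (N n) ↔ n = 0 := by
  simp only [IsEmptyIn, S.mem_nat]
  constructor
  · intro h
    by_contra hn
    exact h (N 0) ⟨0, by omega, rfl⟩
  · rintro rfl z ⟨m, hm, -⟩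
    omega

theorem isInsertIn_succ (S : IsStandardOmega E N o) (n : ℕ) :
    IsInsertIn E (N n) (N n) (N (n + 1)) := by
  intro z
  simp only [S.mem_nat]
  constructor
  · rintro ⟨m, hm, rfl⟩
    rcases Nat.lt_succ_iff_lt_or_eq.1 hm with h | rfl
    · exact .inl ⟨m, h, rfl⟩
    · exact .inr rfl
  · rintro (⟨m, hm, rfl⟩ | rfl)
    · exact ⟨m, by omega, rfl⟩
    · exact ⟨n, by omega, rfl⟩

theorem eq_succ (S : IsStandardOmega E N o) (H : IsModelZFC E) {n : ℕ} {y : M}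
    (h : IsInsertIn E (N n) (N n) y) : y = N (n + 1) :=
  H.insert_unique h (S.isInsertIn_succ n)

/-- If $x=m$ and $m+1<n$, then $m+1$ would be an element of $n = x\cup\{x\}$, although it is neither
below $m$ nor equal to it. -/
theorem eq_pred (S : IsStandardOmega E N o) {n : ℕ} {x : M}
    (h : IsInsertIn E x x (N n)) : ∃ m, n = m + 1 ∧ x = N m := by
  obtain ⟨m, hm, rfl⟩ := (S.mem_nat x n).1 ((h x).2 (.inr rfl))
  refine ⟨m, ?_, rfl⟩
  by_contra hne
  have := (h (N (m + 1))).1 ((S.mem_nat _ _).2 ⟨m + 1, by omega, rfl⟩)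
  rw [S.mem_nat] at this
  rcases this with ⟨k, hk, e⟩ | e
  · have := S.injective e
    omega
  · have := S.injective e
    omega

end IsStandardOmega

/-! ### Recursion and transitive collapse inside a model -/

/-- The internal definition of the sequence that starts with `x₀` and follows the relation `R`:
`y` is the `k`-th value if some set of pairs contains `(k, y)` and justifies all its elements. -/
def IterateIn (E : M → M → Prop) (o x₀ : M) (R : M → M → Prop) (k y : M) : Prop :=
  E k o ∧ ∃ f, PairMem E k y f ∧ ∀ q, E q f → ∃ i z, IsPairIn E i z q ∧
    ((IsEmptyIn E i ∧ z = x₀) ∨ ∃ j w, PairMem E j w f ∧ IsInsertIn E j j i ∧ R w z)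

/-- A sequence given by recursion along a definable relation is definable. -/
theorem isDefinable_sequence (H : IsModelZFC E) {N : ℕ → M} {o : M} (S : IsStandardOmega E N o)
    (x : ℕ → M) {R : M → M → Prop} (hR : IsDefinable E (fun a : Fin 2 → M => R (a 0) (a 1)))
    (hx : ∀ n y, R (x n) y ↔ y = x (n + 1)) :
    IsDefinable E (fun a : Fin 2 → M => ∃ n, a 0 = N n ∧ a 1 = x n) := by
  -- Restated for arbitrary terms so that instance search can use it below quantifiers.
  have hR' : ∀ {α : Type} (f g : (α → M) → M) [IsTerm f] [IsTerm g],
    IsDefinable E (fun a => R (f a) (g a)) := fun f g => hR.subst_two f g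
  have hdef : IsDefinable E (fun a : Fin 2 → M => IterateIn E o (x 0) R (a 0) (a 1)) := by
    unfold IterateIn
    infer_instance
  refine hdef.congr fun a => ⟨?_, ?_⟩
  -- The set `f` need not be a function. Since `k` is a standard natural number, external induction
  -- shows that every value justified in `f` is the true one.
  · rintro ⟨hk, f, hkf, hf⟩
    obtain ⟨n, hn⟩ := (S.mem_omega _).1 hk
    refine ⟨n, hn, ?_⟩
    rw [hn] at hkf
    generalize a 1 = y at hkf
    clear hn hk
    induction n generalizing y with
    | zero =>
      obtain ⟨q, hq, hqp⟩ := hkf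
      obtain ⟨i, z, hp, h⟩ := hf q hq
      obtain ⟨rfl, rfl⟩ := H.pair_injective hqp hp
      rcases h with ⟨-, h⟩ | ⟨j, w, -, h, -⟩
      · exact h
      · obtain ⟨m, h, -⟩ := S.eq_pred h
        omega
    | succ n ih =>
      obtain ⟨q, hq, hqp⟩ := hkf
      obtain ⟨i, z, hp, h⟩ := hf q hq
      obtain ⟨rfl, rfl⟩ := H.pair_injective hqp hp
      rcases h with ⟨h, -⟩ | ⟨j, w, hjw, h, hwy⟩
      · have := S.isEmptyIn_iff.1 h
        omega
      · obtain ⟨m, h, rfl⟩ := S.eq_pred h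
        obtain rfl : n = m := by omega
        obtain rfl := ih w hjw
        exact (hx n y).1 hwy
  · rintro ⟨n, h₀, h₁⟩
    refine ⟨(S.mem_omega _).2 ⟨n, h₀⟩, ?_⟩
    rw [h₀, h₁]
    clear h₀ h₁
    induction n with
    | zero =>
      obtain ⟨p, hp⟩ := H.exists_pair (N 0) (x 0)
      obtain ⟨f, hf⟩ := H.pairing p p
      refine ⟨f, ⟨p, (hf p).2 (.inl rfl), hp⟩, fun q hq => ?_⟩
      obtain rfl : q = p := by simpa using (hf q).1 hq
      exact ⟨_, _, hp, .inl ⟨S.isEmptyIn_iff.2 rfl, rfl⟩⟩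
    | succ n ih =>
      obtain ⟨f, hnf, hf⟩ := ih
      obtain ⟨p, hp⟩ := H.exists_pair (N (n + 1)) (x (n + 1))
      obtain ⟨g, hg⟩ := H.exists_insert p f
      have hpm := H.pairMem_insert hp hg
      refine ⟨g, (hpm _ _).2 (.inr ⟨rfl, rfl⟩), fun q hq => ?_⟩
      rcases (hg q).1 hq with hq | rfl
      · obtain ⟨i, z, hiz, h⟩ := hf q hq
        refine ⟨i, z, hiz, h.imp_right ?_⟩
        rintro ⟨j, w, hjw, h⟩
        exact ⟨j, w, (hpm _ _).2 (.inl hjw), h⟩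
      · exact ⟨_, _, hp, .inr ⟨_, _, (hpm _ _).2 (.inl hnf), S.isInsertIn_succ n,
          (hx _ _).2 rfl⟩⟩

/-- The internal definition of the transitive collapse of the relation `R` on the set `o`. -/
def CollapseIn (E : M → M → Prop) (o : M) (R : M → M → Prop) (k y : M) : Prop :=
  E k o ∧ ∃ f, PairMem E k y f ∧ ∀ q, E q f → ∃ i z, E i o ∧ IsPairIn E i z q ∧
    (∀ w, E w z ↔ ∃ j, E j o ∧ R j i ∧ PairMem E j w f) ∧
    ∀ j, E j o → R j i → ∃ w, PairMem E j w f

/-- The transitive collapse `g` of a definable relation `R`, if all its values exist, is definable.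
-/
theorem isDefinable_collapse (H : IsModelZFC E) (o : M) {R : M → M → Prop}
    (hR : IsDefinable E (fun a : Fin 2 → M => R (a 0) (a 1))) (hwf : WellFounded R)
    (htrans : ∀ i j k, R i j → R j k → R i k) (g : M → M)
    (hg : ∀ k, E k o → ∀ y, E y (g k) ↔ ∃ j, E j o ∧ R j k ∧ y = g j) :
    IsDefinable E (fun a : Fin 2 → M => E (a 0) o ∧ a 1 = g (a 0)) := by
  have hR' : ∀ {α : Type} (f g : (α → M) → M) [IsTerm f] [IsTerm g],
    IsDefinable E (fun a => R (f a) (g a)) := fun f g => hR.subst_two f g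
  have hdef : IsDefinable E (fun a : Fin 2 → M => CollapseIn E o R (a 0) (a 1)) := by
    unfold CollapseIn
    infer_instance
  have hdef' : ∀ {α : Type} (f g : (α → M) → M) [IsTerm f] [IsTerm g],
    IsDefinable E (fun a => CollapseIn E o R (f a) (g a)) := fun f g => hdef.subst_two f g
  -- Induction along `R`, which is well-founded in the outside world. The last clause of
  -- `CollapseIn` is what prevents `f` from omitting a predecessor and making the value too small.
  have sound : ∀ k y, CollapseIn E o R k y → y = g k := by
    rintro k y ⟨-, f, hkf, hf⟩
    induction k using hwf.induction generalizing y with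
    | _ k ih =>
      obtain ⟨q, hq, hqp⟩ := hkf
      obtain ⟨i, z, hi, hp, h₁, h₂⟩ := hf q hq
      obtain ⟨rfl, rfl⟩ := H.pair_injective hqp hp
      refine H.extensionality _ _ fun w => ?_
      rw [h₁, hg k hi]
      refine exists_congr fun j => and_congr_right fun hj => and_congr_right fun hjk => ?_
      refine ⟨fun h => ih j hjk w h, ?_⟩
      rintro rfl
      obtain ⟨w, hw⟩ := h₂ j hj hjk
      rwa [← ih j hjk w hw]
  refine hdef.congr fun a => ⟨fun h => ⟨h.1, sound _ _ h⟩, ?_⟩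
  rintro ⟨hk, h⟩
  rw [h]
  generalize a 0 = k at hk
  clear h a
  induction k using hwf.induction with
  | _ k ih =>
    -- Replacement collects the graph of `g` on the predecessors of `k`; by soundness the internal
    -- definition is single-valued. Adding the pair for `k` gives the required witness.
    obtain ⟨h, hh⟩ := H.exists_image
      (R := fun j q => R j k ∧ ∃ y, CollapseIn E o R j y ∧ IsPairIn E j y q) inferInstance
      (by
        rintro j q q' ⟨-, y, hy, hq⟩ ⟨-, y', hy', hq'⟩
        obtain rfl := sound _ _ hy
        obtain rfl := sound _ _ hy'
        exact H.pair_unique hq hq') o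
    obtain ⟨p, hp⟩ := H.exists_pair k (g k)
    obtain ⟨f, hf⟩ := H.exists_insert p h
    have hmem : ∀ j w, PairMem E j w h ↔ E j o ∧ R j k ∧ w = g j := by
      intro j w
      obtain ⟨q, hq⟩ := H.exists_pair j w
      rw [H.pairMem_iff hq, hh]
      constructor
      · rintro ⟨i, hi, hik, z, hiz, hq'⟩
        obtain ⟨rfl, rfl⟩ := H.pair_injective hq hq'
        exact ⟨hi, hik, sound _ _ hiz⟩
      · rintro ⟨hj, hjk, rfl⟩
        exact ⟨j, hj, hjk, _, ih j hjk hj, hq⟩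
    have hpm := H.pairMem_insert hp hf
    refine ⟨hk, f, (hpm _ _).2 (.inr ⟨rfl, rfl⟩), fun q hq => ?_⟩
    obtain ⟨i, hi, hik, hiq⟩ : ∃ i, E i o ∧ (i = k ∨ R i k) ∧ IsPairIn E i (g i) q := by
      rcases (hf q).1 hq with hq | rfl
      · obtain ⟨i, hi, hik, z, hiz, hp⟩ := (hh q).1 hq
        obtain rfl := sound _ _ hiz
        exact ⟨i, hi, .inr hik, hp⟩
      · exact ⟨k, hk, .inl rfl, hp⟩
    -- Transitivity of `R` makes the domain of `f` closed under predecessors.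
    have hbelow : ∀ j, R j i → R j k := fun j hj => by
      rcases hik with rfl | hik
      · exact hj
      · exact htrans _ _ _ hj hik
    refine ⟨i, g i, hi, hiq, fun w => ?_,
      fun j hj hji => ⟨g j, (hpm _ _).2 (.inl ((hmem _ _).2 ⟨hj, hbelow j hji, rfl⟩))⟩⟩
    rw [hg i hi]
    refine exists_congr fun j => and_congr_right fun hj => and_congr_right fun hji => ?_
    rw [hpm, hmem]
    constructor
    · exact fun h => .inl ⟨hj, hbelow j hji, h⟩
    · rintro (h | ⟨rfl, rfl⟩)
      · exact h.2.2
      · rfl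

end Models

/-! ### Natural numbers and finite binary sequences as sets -/

/-- The von Neumann natural number `n`. -/
noncomputable def nat : ℕ → ZFSet.{u}
  | 0 => ∅
  | n + 1 => insert (nat n) (nat n)

theorem mem_nat {x : ZFSet.{u}} {n : ℕ} : x ∈ nat n ↔ ∃ m < n, x = nat m := by
  induction n with
  | zero => simp [nat]
  | succ n ih =>
    rw [nat, ZFSet.mem_insert_iff, ih]
    constructor
    · rintro (rfl | ⟨m, hm, rfl⟩)
      · exact ⟨n, by omega, rfl⟩
      · exact ⟨m, by omega, rfl⟩
    · rintro ⟨m, hm, rfl⟩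
      rcases Nat.lt_succ_iff_lt_or_eq.1 hm with h | rfl
      · exact .inr ⟨m, h, rfl⟩
      · exact .inl rfl

theorem nat_injective : Function.Injective nat.{u} := by
  intro m n h
  by_contra hne
  rcases Nat.lt_or_gt_of_ne hne with hlt | hlt
  · have hmem : nat.{u} m ∈ nat n := mem_nat.2 ⟨m, hlt, rfl⟩
    rw [h] at hmem
    exact ZFSet.mem_irrefl _ hmem
  · have hmem : nat.{u} n ∈ nat m := mem_nat.2 ⟨n, hlt, rfl⟩
    rw [h] at hmem
    exact ZFSet.mem_irrefl _ hmem

theorem mem_omega {x : ZFSet.{u}} : x ∈ ZFSet.omega ↔ ∃ n, x = nat n := by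
  have key : ∀ n, ZFSet.mk (PSet.ofNat n) = nat.{u} n := by
    intro n
    induction n with
    | zero => rfl
    | succ n ih =>
      rw [nat, ← ih]
      rfl
  constructor
  · induction x using Quotient.inductionOn with
    | _ x =>
      rintro ⟨⟨n⟩, h⟩
      exact ⟨n, (ZFSet.sound h).trans (key n)⟩
  · rintro ⟨n, rfl⟩
    induction n with
    | zero => exact ZFSet.omega_zero
    | succ n ih => exact ZFSet.omega_succ ih

theorem isOrdinal_nat (n : ℕ) : (nat.{u} n).IsOrdinal := by
  have htr : ∀ n, (nat.{u} n).IsTransitive := by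
    intro n y hy z hz
    obtain ⟨m, hm, rfl⟩ := mem_nat.1 hy
    obtain ⟨k, hk, rfl⟩ := mem_nat.1 hz
    exact mem_nat.2 ⟨k, by omega, rfl⟩
  refine ZFSet.isOrdinal_iff_forall_mem_isTransitive.2 ⟨htr n, fun y hy => ?_⟩
  obtain ⟨m, hm, rfl⟩ := mem_nat.1 hy
  exact htr m

theorem isOrdinal_omega : ZFSet.omega.{u}.IsOrdinal := by
  refine ZFSet.isOrdinal_iff_forall_mem_isTransitive.2 ⟨fun y hy z hz => ?_, fun y hy => ?_⟩ <;>
    obtain ⟨n, rfl⟩ := mem_omega.1 hy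
  · obtain ⟨m, hm, rfl⟩ := mem_nat.1 hz
    exact mem_omega.2 ⟨m, rfl⟩
  · exact (isOrdinal_nat n).isTransitive

/-- The elements `0` and `1` of `two`. -/
noncomputable def bit (i : Bool) : ZFSet.{u} := if i then {∅} else ∅

theorem bit_injective : Function.Injective bit.{u} := by
  have h : ({∅} : ZFSet.{u}) ≠ ∅ := fun h => by
    have hmem : (∅ : ZFSet.{u}) ∈ ({∅} : ZFSet.{u}) := ZFSet.mem_singleton.2 rfl
    rw [h] at hmem
    exact ZFSet.notMem_empty _ hmem
  intro i j
  cases i <;> cases j <;> simp [bit, h, h.symm]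

theorem mem_two {x : ZFSet.{u}} : x ∈ two ↔ ∃ i, x = bit i := by
  simp [two, bit]

/-- The restriction of the binary sequence `b` to its first `n` places. -/
noncomputable def segment (b : ℕ → Bool) : ℕ → ZFSet.{u}
  | 0 => ∅
  | n + 1 => insert (ZFSet.pair (nat n) (bit (b n))) (segment b n)

/-- The binary sequence `b` as a function from `ω` to `2`. -/
noncomputable def real (b : ℕ → Bool) : ZFSet.{u} :=
  ZFSet.range fun n : ULift.{u} ℕ => ZFSet.pair (nat n.down) (bit (b n.down))

theorem mem_segment {b : ℕ → Bool} {n : ℕ} {x : ZFSet.{u}} :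
    x ∈ segment b n ↔ ∃ m < n, x = ZFSet.pair (nat m) (bit (b m)) := by
  induction n with
  | zero => simp [segment]
  | succ n ih =>
    rw [segment, ZFSet.mem_insert_iff, ih]
    constructor
    · rintro (rfl | ⟨m, hm, rfl⟩)
      · exact ⟨n, by omega, rfl⟩
      · exact ⟨m, by omega, rfl⟩
    · rintro ⟨m, hm, rfl⟩
      rcases Nat.lt_succ_iff_lt_or_eq.1 hm with h | rfl
      · exact .inr ⟨m, h, rfl⟩
      · exact .inl rfl

theorem pair_mem_segment {b : ℕ → Bool} {n k : ℕ} {i : Bool} :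
    ZFSet.pair (nat.{u} k) (bit i) ∈ segment b n ↔ k < n ∧ b k = i := by
  rw [mem_segment]
  constructor
  · rintro ⟨m, hm, h⟩
    obtain ⟨h₁, h₂⟩ := ZFSet.pair_injective h
    obtain rfl := nat_injective h₁
    exact ⟨hm, (bit_injective h₂).symm⟩
  · rintro ⟨hk, rfl⟩
    exact ⟨k, hk, rfl⟩

theorem mem_real {b : ℕ → Bool} {x : ZFSet.{u}} :
    x ∈ real b ↔ ∃ m, x = ZFSet.pair (nat m) (bit (b m)) := by
  simp [real, eq_comm]

theorem segment_congr {b b' : ℕ → Bool} {n : ℕ} (h : ∀ k < n, b' k = b k) :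
    segment.{u} b' n = segment b n := by
  induction n with
  | zero => rfl
  | succ n ih => rw [segment, segment, h n (by omega), ih fun k hk => h k (by omega)]

theorem segment_mono (b : ℕ → Bool) {m n : ℕ} (h : m ≤ n) :
    segment.{u} b m ⊆ segment b n := by
  intro x hx
  obtain ⟨k, hk, rfl⟩ := mem_segment.1 hx
  exact mem_segment.2 ⟨k, by omega, rfl⟩

theorem eq_of_segment_subset {b b' : ℕ → Bool} {m n : ℕ}
    (h : segment.{u} b m ⊆ segment b' n) : ∀ k < m, b' k = b k := by
  intro k hk
  exact (pair_mem_segment.1 (h (mem_segment.2 ⟨k, hk, rfl⟩))).2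

theorem isFunc_real (b : ℕ → Bool) : ZFSet.IsFunc ZFSet.omega two (real.{u} b) := by
  refine ⟨fun x hx => ?_, fun k hk => ?_⟩
  · obtain ⟨m, rfl⟩ := mem_real.1 hx
    exact ZFSet.pair_mem_prod.2 ⟨mem_omega.2 ⟨m, rfl⟩, mem_two.2 ⟨_, rfl⟩⟩
  · obtain ⟨n, rfl⟩ := mem_omega.1 hk
    refine ⟨bit (b n), mem_real.2 ⟨n, rfl⟩, fun y hy => ?_⟩
    obtain ⟨m, h⟩ := mem_real.1 hy
    obtain ⟨h₁, rfl⟩ := ZFSet.pair_injective h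
    rw [nat_injective h₁]

theorem isFunc_segment (b : ℕ → Bool) (n : ℕ) : ZFSet.IsFunc (nat n) two (segment.{u} b n) := by
  refine ⟨fun x hx => ?_, fun k hk => ?_⟩
  · obtain ⟨m, hm, rfl⟩ := mem_segment.1 hx
    exact ZFSet.pair_mem_prod.2 ⟨mem_nat.2 ⟨m, hm, rfl⟩, mem_two.2 ⟨_, rfl⟩⟩
  · obtain ⟨m, hm, rfl⟩ := mem_nat.1 hk
    refine ⟨bit (b m), mem_segment.2 ⟨m, hm, rfl⟩, fun y hy => ?_⟩
    obtain ⟨l, -, h⟩ := mem_segment.1 hy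
    obtain ⟨h₁, rfl⟩ := ZFSet.pair_injective h
    rw [nat_injective h₁]

theorem mem_cohenPoset_iff_isFunc {p : ZFSet.{u}} :
    p ∈ cohenPoset ↔ ∃ n ∈ ZFSet.omega, ZFSet.IsFunc n two p := by
  rw [cohenPoset, ZFSet.mem_sep, and_iff_right_iff_imp]
  rintro ⟨n, hn, hp⟩
  refine ZFSet.mem_powerset.2 fun x hx => ?_
  obtain ⟨a, ha, i, hi, rfl⟩ := ZFSet.mem_prod.1 (hp.1 hx)
  exact ZFSet.pair_mem_prod.2 ⟨isOrdinal_omega.mem_trans ha hn, hi⟩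

/-- Lets conditions be handled as initial segments of total sequences; the values of `b` beyond `n`
are irrelevant. -/
theorem mem_cohenPoset {p : ZFSet.{u}} : p ∈ cohenPoset ↔ ∃ b n, p = segment b n := by
  classical
  rw [mem_cohenPoset_iff_isFunc]
  constructor
  · rintro ⟨_, hn, hp, hf⟩
    obtain ⟨n, rfl⟩ := mem_omega.1 hn
    have hbit : ∀ k i, ZFSet.pair (nat k) (bit i) ∈ p → k < n ∧
        i = decide (ZFSet.pair (nat k) (bit true) ∈ p) := by
      intro k i h
      have hk := (ZFSet.pair_mem_prod.1 (hp h)).1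
      refine ⟨?_, ?_⟩
      · obtain ⟨m, hm, e⟩ := mem_nat.1 hk
        rwa [nat_injective e]
      · cases i with
        | true => simp [h]
        | false =>
          refine (decide_eq_false fun h' => ?_).symm
          exact Bool.false_ne_true (bit_injective ((hf _ hk).unique h h'))
    refine ⟨fun k => decide (ZFSet.pair (nat k) (bit true) ∈ p), n, ZFSet.ext fun x => ?_⟩
    rw [mem_segment]
    constructor
    · intro hx
      obtain ⟨_, hkn, _, hi, rfl⟩ := ZFSet.mem_prod.1 (hp hx)
      obtain ⟨k, hk, rfl⟩ := mem_nat.1 hkn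
      obtain ⟨i, rfl⟩ := mem_two.1 hi
      exact ⟨k, hk, by rw [← (hbit k i hx).2]⟩
    · rintro ⟨k, hk, rfl⟩
      obtain ⟨_, hw, -⟩ := hf _ (mem_nat.2 ⟨k, hk, rfl⟩)
      obtain ⟨i, rfl⟩ := mem_two.1 (ZFSet.pair_mem_prod.1 (hp hw)).2
      rwa [← (hbit k i hw).2]
  · rintro ⟨b, n, rfl⟩
    exact ⟨_, mem_omega.2 ⟨n, rfl⟩, isFunc_segment b n⟩

theorem segment_mem_cohenPoset (b : ℕ → Bool) (n : ℕ) : segment.{u} b n ∈ cohenPoset :=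
  mem_cohenPoset.2 ⟨b, n, rfl⟩

theorem mem_cohenFilter {b : ℕ → Bool} {p : ZFSet.{u}} :
    p ∈ cohenFilter (real b) ↔ ∃ n, p = segment b n := by
  rw [cohenFilter, ZFSet.mem_sep, mem_cohenPoset]
  constructor
  · rintro ⟨⟨b', n, rfl⟩, h⟩
    refine ⟨n, segment_congr fun k hk => ?_⟩
    obtain ⟨m, h⟩ := mem_real.1 (h (mem_segment.2 ⟨k, hk, rfl⟩))
    obtain ⟨h₁, h₂⟩ := ZFSet.pair_injective h
    rw [bit_injective h₂, nat_injective h₁]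
  · rintro ⟨n, rfl⟩
    refine ⟨⟨b, n, rfl⟩, fun x hx => ?_⟩
    obtain ⟨k, -, rfl⟩ := mem_segment.1 hx
    exact mem_real.2 ⟨k, rfl⟩

/-! ### Existence of generic reals -/

/-- The set of binary sequences with an initial segment in `D`. -/
def meets (D : ZFSet.{u}) : Set (ℕ → Bool) := {b | ∃ n, segment b n ∈ D}

theorem isOpen_meets (D : ZFSet.{u}) : IsOpen (meets D) := by
  rw [isOpen_iff_forall_mem_open]
  rintro b ⟨n, hn⟩
  refine ⟨PiNat.cylinder b n, fun b' hb' => ⟨n, ?_⟩, PiNat.isOpen_cylinder _ b n,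
    PiNat.self_mem_cylinder b n⟩
  rwa [segment_congr fun k hk => hb' k hk]

theorem dense_meets {D : ZFSet.{u}} (hD : ∀ p ∈ D, p ∈ cohenPoset)
    (hdense : ∀ p ∈ cohenPoset, ∃ q ∈ D, cohenLE q p) : Dense (meets D) := by
  rw [(PiNat.isTopologicalBasis_cylinders _).dense_iff]
  rintro _ ⟨b, n, rfl⟩ -
  obtain ⟨q, hq, hle⟩ := hdense _ (segment_mem_cohenPoset b n)
  obtain ⟨b', m, rfl⟩ := mem_cohenPoset.1 (hD q hq)
  exact ⟨b', fun k hk => eq_of_segment_subset hle k hk, m, hq⟩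

theorem isCohenReal_real {W : ZFSet.{u}} {b : ℕ → Bool}
    (h : ∀ D ∈ W, (∀ p ∈ D, p ∈ cohenPoset) → (∀ p ∈ cohenPoset, ∃ q ∈ D, cohenLE q p) →
      b ∈ meets D) : IsCohenReal W (real b) := by
  refine ⟨isFunc_real b, ?_, ⟨_, mem_cohenFilter.2 ⟨0, rfl⟩⟩, ?_, ?_, ?_⟩
  · exact fun p hp => (ZFSet.mem_sep.1 hp).1
  · exact fun p hp q hq hle => ZFSet.mem_sep.2 ⟨hq, fun x hx => (ZFSet.mem_sep.1 hp).2 (hle hx)⟩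
  · intro p hp q hq
    obtain ⟨m, rfl⟩ := mem_cohenFilter.1 hp
    obtain ⟨n, rfl⟩ := mem_cohenFilter.1 hq
    exact ⟨_, mem_cohenFilter.2 ⟨max m n, rfl⟩, segment_mono b (le_max_left _ _),
      segment_mono b (le_max_right _ _)⟩
  · intro D hD h₁ h₂
    obtain ⟨n, hn⟩ := h D hD h₁ h₂
    exact ⟨_, mem_cohenFilter.2 ⟨n, rfl⟩, hn⟩

/-- Addition of `z` modulo `2` on the Cantor space. -/
def xorHomeomorph (z : ℕ → Bool) : (ℕ → Bool) ≃ₜ (ℕ → Bool) where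
  toFun b n := xor (b n) (z n)
  invFun b n := xor (b n) (z n)
  left_inv b := by simp
  right_inv b := by simp
  continuous_toFun := by
    refine continuous_pi fun n => ?_
    exact (continuous_of_discreteTopology (f := fun i : Bool => xor i (z n))).comp
      (continuous_apply n)
  continuous_invFun := by
    refine continuous_pi fun n => ?_
    exact (continuous_of_discreteTopology (f := fun i : Bool => xor i (z n))).comp
      (continuous_apply n)

/-- Over a countable set, every real is the difference of two generic reals. -/
theorem exists_isCohenReal_xor {W : ZFSet.{u}} (hW : (W : Set ZFSet.{u}).Countable)
    (z : ℕ → Bool) :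
    ∃ b : ℕ → Bool, IsCohenReal W (real b) ∧ IsCohenReal W (real fun n => xor (b n) (z n)) := by
  let S : Set ZFSet.{u} := {D | D ∈ W ∧ (∀ p ∈ D, p ∈ cohenPoset) ∧
    ∀ p ∈ cohenPoset, ∃ q ∈ D, cohenLE q p}
  have hS : S.Countable := hW.mono fun D hD => hD.1
  -- Baire category: the preimage under translation by `z` expresses that the translate of `b` meets
  -- `D`.
  have key : Dense (⋂ D ∈ S, meets D ∩ xorHomeomorph z ⁻¹' meets D) := by
    refine dense_biInter_of_isOpen (fun D _ => ?_) hS fun D hD => ?_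
    · exact (isOpen_meets D).inter ((isOpen_meets D).preimage (xorHomeomorph z).continuous)
    · have h := dense_meets hD.2.1 hD.2.2
      exact h.inter_of_isOpen_left (h.preimage (xorHomeomorph z).isOpenMap) (isOpen_meets D)
  obtain ⟨b, hb⟩ := key.nonempty
  rw [Set.mem_iInter₂] at hb
  exact ⟨b, isCohenReal_real fun D h₀ h₁ h₂ => (hb D ⟨h₀, h₁, h₂⟩).1,
    isCohenReal_real fun D h₀ h₁ h₂ => (hb D ⟨h₀, h₁, h₂⟩).2⟩

/-! ### Transitive models -/

namespace IsCTM

variable {W : ZFSet.{u}}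

theorem mem_trans (hW : IsCTM W) {x y : ZFSet.{u}} (hx : x ∈ y) (hy : y ∈ W) : x ∈ W :=
  hW.transitive.mem_trans hx hy

/-- The source of absoluteness: all elements of `x` lie in the transitive set `W`, so a description
of the elements that is checked only inside `W` determines `x`. -/
theorem ext_iff (hW : IsCTM W) {x : ZFSet.{u}} (hx : x ∈ W) {P : ZFSet.{u} → Prop}
    {y : ZFSet.{u}} (hy : ∀ z, z ∈ y ↔ P z) (hP : ∀ z, P z → z ∈ W) :
    (∀ z : {z // z ∈ W}, z.1 ∈ x ↔ P z.1) ↔ x = y := by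
  constructor
  · exact fun h => ZFSet.ext fun z => Iff.trans
      ⟨fun hz => (h ⟨z, hW.mem_trans hz hx⟩).1 hz, fun hz => (h ⟨z, hP z hz⟩).2 hz⟩ (hy z).symm
  · rintro rfl z
    exact hy z

theorem isEmptyIn_iff (hW : IsCTM W) {x : {x // x ∈ W}} :
    IsEmptyIn (memOn W) x ↔ x.1 = ∅ := by
  rw [← hW.ext_iff x.2 (P := fun _ => False) (by simp) (by simp)]
  simp [IsEmptyIn, memOn]

theorem isInsertIn_iff (hW : IsCTM W) {w x y : {x // x ∈ W}} :
    IsInsertIn (memOn W) w x y ↔ y.1 = insert w.1 x.1 := by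
  rw [← hW.ext_iff y.2 (P := fun z => z ∈ x.1 ∨ z = w.1)
    (fun z => by rw [ZFSet.mem_insert_iff, or_comm])]
  · exact forall_congr' fun z => by rw [Subtype.ext_iff]; rfl
  · rintro z (h | rfl)
    · exact hW.mem_trans h x.2
    · exact w.2

theorem isUpairIn_iff (hW : IsCTM W) {x y z : {x // x ∈ W}} :
    IsUpairIn (memOn W) x y z ↔ z.1 = {x.1, y.1} := by
  rw [← hW.ext_iff z.2 (P := fun w => w = x.1 ∨ w = y.1) (fun z => ZFSet.mem_pair)]
  · exact forall_congr' fun z => by rw [Subtype.ext_iff, Subtype.ext_iff]; rfl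
  · rintro z (rfl | rfl)
    · exact x.2
    · exact y.2

theorem upair_mem (hW : IsCTM W) {x y : ZFSet.{u}} (hx : x ∈ W) (hy : y ∈ W) :
    ({x, y} : ZFSet.{u}) ∈ W := by
  obtain ⟨z, hz⟩ := hW.zfc.pairing ⟨x, hx⟩ ⟨y, hy⟩
  exact hW.isUpairIn_iff.1 hz ▸ z.2

theorem isPairIn_iff (hW : IsCTM W) {x y p : {x // x ∈ W}} :
    IsPairIn (memOn W) x y p ↔ p.1 = ZFSet.pair x.1 y.1 := by
  rw [← hW.ext_iff p.2 (P := fun w => w = {x.1, x.1} ∨ w = {x.1, y.1})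
    (fun z => by simp [ZFSet.pair])]
  · exact forall_congr' fun z => by rw [hW.isUpairIn_iff, hW.isUpairIn_iff]; rfl
  · rintro z (rfl | rfl)
    · exact hW.upair_mem x.2 x.2
    · exact hW.upair_mem x.2 y.2

theorem pair_mem (hW : IsCTM W) {x y : ZFSet.{u}} (hx : x ∈ W) (hy : y ∈ W) :
    ZFSet.pair x y ∈ W := by
  obtain ⟨z, hz⟩ := hW.zfc.exists_pair ⟨x, hx⟩ ⟨y, hy⟩
  exact hW.isPairIn_iff.1 hz ▸ z.2

theorem pairMem_iff (hW : IsCTM W) {x y f : {x // x ∈ W}} :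
    PairMem (memOn W) x y f ↔ ZFSet.pair x.1 y.1 ∈ f.1 := by
  constructor
  · rintro ⟨p, hp, h⟩
    exact hW.isPairIn_iff.1 h ▸ hp
  · intro h
    exact ⟨⟨_, hW.pair_mem x.2 y.2⟩, h, hW.isPairIn_iff.2 rfl⟩

theorem insert_mem (hW : IsCTM W) {x y : ZFSet.{u}} (hx : x ∈ W) (hy : y ∈ W) :
    insert x y ∈ W := by
  obtain ⟨z, hz⟩ := hW.zfc.exists_insert ⟨x, hx⟩ ⟨y, hy⟩
  exact hW.isInsertIn_iff.1 hz ▸ z.2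

theorem empty_mem (hW : IsCTM W) : ∅ ∈ W := by
  obtain ⟨z, hz⟩ := hW.zfc.exists_empty
  exact hW.isEmptyIn_iff.1 hz ▸ z.2

theorem nat_mem (hW : IsCTM W) (n : ℕ) : nat n ∈ W := by
  induction n with
  | zero => exact hW.empty_mem
  | succ n ih => exact hW.insert_mem ih ih

theorem bit_mem (hW : IsCTM W) (i : Bool) : bit i ∈ W := by
  cases i with
  | false => exact hW.empty_mem
  | true => exact hW.nat_mem 1 |> fun h => by simpa [nat, bit] using h

theorem segment_mem (hW : IsCTM W) (b : ℕ → Bool) (n : ℕ) : segment b n ∈ W := by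
  induction n with
  | zero => exact hW.empty_mem
  | succ n ih => exact hW.insert_mem (hW.pair_mem (hW.nat_mem n) (hW.bit_mem _)) ih

theorem two_mem (hW : IsCTM W) : two ∈ W := hW.upair_mem hW.empty_mem (hW.bit_mem true)

/-- A definable subclass of a set of the model belongs to the model. -/
theorem sep_mem (hW : IsCTM W) {a : ZFSet.{u}} (ha : a ∈ W) {R : {x // x ∈ W} → Prop}
    (hR : IsDefinable (memOn W) (fun v : Fin 1 → {x // x ∈ W} => R (v 0))) :
    ∃ b ∈ W, ∀ x, x ∈ b ↔ x ∈ a ∧ ∃ h : x ∈ W, R ⟨x, h⟩ := by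
  obtain ⟨b, hb⟩ := hW.zfc.exists_sep hR ⟨a, ha⟩
  refine ⟨b.1, b.2, fun x => ⟨fun h => ?_, ?_⟩⟩
  · have hx := hW.mem_trans h b.2
    have := (hb ⟨x, hx⟩).1 h
    exact ⟨this.1, hx, this.2⟩
  · rintro ⟨h, hx, hR⟩
    exact (hb ⟨x, hx⟩).2 ⟨h, hR⟩

theorem powerset_mem (hW : IsCTM W) {a : ZFSet.{u}} (ha : a ∈ W) :
    ∃ p ∈ W, ∀ x, x ∈ p ↔ x ∈ W ∧ x ⊆ a := by
  obtain ⟨p, hp⟩ := hW.zfc.powerset ⟨a, ha⟩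
  refine ⟨p.1, p.2, fun x => ⟨fun h => ?_, ?_⟩⟩
  · have hx := hW.mem_trans h p.2
    exact ⟨hx, fun z hz => (hp ⟨x, hx⟩).1 h ⟨z, hW.mem_trans hz hx⟩ hz⟩
  · rintro ⟨hx, h⟩
    exact (hp ⟨x, hx⟩).2 fun z hz => h hz

/-- Some set of the model contains all pairs of elements of a given one. -/
theorem exists_pairs (hW : IsCTM W) {a : ZFSet.{u}} (ha : a ∈ W) :
    ∃ p ∈ W, ∀ x ∈ a, ∀ y ∈ a, ZFSet.pair x y ∈ p := by
  obtain ⟨p, hp, hpa⟩ := hW.powerset_mem ha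
  obtain ⟨q, hq, hqp⟩ := hW.powerset_mem hp
  refine ⟨q, hq, fun x hx y hy => (hqp _).2
    ⟨hW.pair_mem (hW.mem_trans hx ha) (hW.mem_trans hy ha), fun z hz => ?_⟩⟩
  have hx' := hW.mem_trans hx ha
  have hy' := hW.mem_trans hy ha
  rw [ZFSet.pair, ZFSet.mem_pair] at hz
  rcases hz with rfl | rfl
  · exact (hpa _).2 ⟨by simpa using hW.upair_mem hx' hx', fun w hw => by
      rwa [ZFSet.mem_singleton.1 hw]⟩
  · refine (hpa _).2 ⟨hW.upair_mem hx' hy', fun w hw => ?_⟩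
    rcases ZFSet.mem_pair.1 hw with rfl | rfl <;> assumption

theorem union_mem (hW : IsCTM W) {a b : ZFSet.{u}} (ha : a ∈ W) (hb : b ∈ W) : a ∪ b ∈ W := by
  obtain ⟨x, hx⟩ := hW.zfc.union ⟨_, hW.upair_mem ha hb⟩
  have : x.1 = a ∪ b := by
    refine (hW.ext_iff x.2 (P := fun z => z ∈ a ∨ z ∈ b) (fun z => ZFSet.mem_union) ?_).1
      fun z => (hx z).trans ⟨?_, ?_⟩
    · rintro z (h | h)
      · exact hW.mem_trans h ha
      · exact hW.mem_trans h hb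
    · rintro ⟨y, hy, hz⟩
      rcases ZFSet.mem_pair.1 hy with h | h
      · exact .inl (h ▸ hz)
      · exact .inr (h ▸ hz)
    · rintro (h | h)
      · exact ⟨⟨a, ha⟩, ZFSet.mem_pair.2 (.inl rfl), h⟩
      · exact ⟨⟨b, hb⟩, ZFSet.mem_pair.2 (.inr rfl), h⟩
  exact this ▸ x.2

theorem omega_mem (hW : IsCTM W) : ZFSet.omega ∈ W := by
  let Ind : {x // x ∈ W} → Prop := fun w => (∃ e, memOn W e w ∧ IsEmptyIn (memOn W) e) ∧
    ∀ x, memOn W x w → ∃ y, memOn W y w ∧ IsInsertIn (memOn W) x x y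
  have hInd : ∀ w, Ind w ↔ ∅ ∈ w.1 ∧ ∀ x ∈ w.1, insert x x ∈ w.1 := by
    intro w
    refine and_congr ⟨?_, fun h => ?_⟩ ⟨fun h x hx => ?_, fun h x hx => ?_⟩
    · rintro ⟨e, he, h⟩
      exact hW.isEmptyIn_iff.1 h ▸ he
    · exact ⟨⟨∅, hW.empty_mem⟩, h, hW.isEmptyIn_iff.2 rfl⟩
    · obtain ⟨y, hy, h⟩ := h ⟨x, hW.mem_trans hx w.2⟩ hx
      exact hW.isInsertIn_iff.1 h ▸ hy
    · exact ⟨⟨_, hW.insert_mem x.2 x.2⟩, h _ hx, hW.isInsertIn_iff.2 rfl⟩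
  obtain ⟨w, hw⟩ : ∃ w, Ind w := by
    obtain ⟨w, ⟨e, he, h⟩, hw⟩ := hW.zfc.infinity
    exact ⟨w, ⟨e, he, h⟩, hw⟩
  -- The least inductive set in the sense of `W`.
  obtain ⟨o, ho, hmem⟩ := hW.sep_mem w.2 (R := fun x => ∀ v, Ind v → memOn W x v)
    inferInstance
  have hsub : ∀ v, Ind v → ∀ n, nat n ∈ v.1 := by
    intro v hv n
    rw [hInd] at hv
    induction n with
    | zero => exact hv.1
    | succ n ih => exact hv.2 _ ih
  have ho' : Ind ⟨o, ho⟩ := by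
    rw [hInd]
    refine ⟨(hmem _).2 ⟨hsub w hw 0, hW.empty_mem, fun v hv => hsub v hv 0⟩, fun x hx => ?_⟩
    obtain ⟨hxw, h, hx⟩ := (hmem x).1 hx
    exact (hmem _).2 ⟨((hInd w).1 hw).2 x hxw, hW.insert_mem h h,
      fun v hv => ((hInd v).1 hv).2 x (hx v hv)⟩
  suffices o = ZFSet.omega from this ▸ ho
  refine ZFSet.ext fun x => ?_
  rw [mem_omega]
  constructor
  · intro hx
    induction x using ZFSet.inductionOn with
    | _ x ih =>
      by_contra hne
      -- Remove a non-natural `x` from `o`. The rest is still inductive, as `x` is not empty and, by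
      -- the induction hypothesis, not the successor of an element of `o`. This contradicts
      -- minimality.
      obtain ⟨o', ho'', hmem'⟩ := hW.sep_mem ho
        (R := fun y => ¬ y = ⟨x, hW.mem_trans hx ho⟩) inferInstance
      have hx' : x ∈ o' := by
        refine ((hmem x).1 hx).2.2 ⟨o', ho''⟩ ((hInd _).2 ⟨?_, fun y hy => ?_⟩)
        · refine (hmem' _).2 ⟨hsub _ ho' 0, hW.empty_mem, fun h => hne ⟨0, ?_⟩⟩
          exact (congrArg Subtype.val h).symm
        · obtain ⟨hy, hyW, hyx⟩ := (hmem' y).1 hy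
          refine (hmem' _).2 ⟨((hInd _).1 ho').2 y hy, hW.insert_mem hyW hyW, fun h => ?_⟩
          have h : insert y y = x := congrArg Subtype.val h
          obtain ⟨n, rfl⟩ := ih y (h ▸ ZFSet.mem_insert y y) hy
          exact hne ⟨n + 1, h.symm⟩
      exact ((hmem' x).1 hx').2.2 rfl
  · rintro ⟨n, rfl⟩
    exact hsub _ ho' n

theorem isStandardOmega (hW : IsCTM W) :
    IsStandardOmega (memOn W) (fun n => ⟨nat n, hW.nat_mem n⟩) ⟨ZFSet.omega, hW.omega_mem⟩ where
  mem_omega x := by simp [memOn, mem_omega, Subtype.ext_iff]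
  mem_nat x n := by simp [memOn, mem_nat, Subtype.ext_iff]
  injective m n h := nat_injective (congrArg Subtype.val h)

end IsCTM

/-! ### A name for the Cohen real -/

/-- The canonical name of the natural number `n`. -/
noncomputable def natName : ℕ → ZFSet.{u}
  | 0 => ∅
  | n + 1 => insert (ZFSet.pair (natName n) ∅) (natName n)

theorem mem_natName {x : ZFSet.{u}} {n : ℕ} :
    x ∈ natName n ↔ ∃ m < n, x = ZFSet.pair (natName m) ∅ := by
  induction n with
  | zero => simp [natName]
  | succ n ih =>
    rw [natName, ZFSet.mem_insert_iff, ih]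
    constructor
    · rintro (rfl | ⟨m, hm, rfl⟩)
      · exact ⟨n, by omega, rfl⟩
      · exact ⟨m, by omega, rfl⟩
    · rintro ⟨m, hm, rfl⟩
      rcases Nat.lt_succ_iff_lt_or_eq.1 hm with h | rfl
      · exact .inr ⟨m, h, rfl⟩
      · exact .inl rfl

theorem isName_natName {P : ZFSet.{u}} (hP : ∅ ∈ P) (n : ℕ) : IsName P (natName n) := by
  induction n using Nat.strong_induction_on with
  | _ n ih =>
    refine .mk _ (fun x hx => ?_) fun σ p h => ?_
    · obtain ⟨m, -, rfl⟩ := mem_natName.1 hx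
      exact ⟨_, _, hP, rfl⟩
    · obtain ⟨m, hm, h⟩ := mem_natName.1 h
      rw [(ZFSet.pair_injective h).1]
      exact ih m hm

theorem val_natName {G : ZFSet.{u}} (hG : ∅ ∈ G) (n : ℕ) : val G (natName n) = nat n := by
  induction n using Nat.strong_induction_on with
  | _ n ih =>
    refine ZFSet.ext fun x => ?_
    rw [mem_val, mem_nat]
    constructor
    · rintro ⟨σ, p, -, h, rfl⟩
      obtain ⟨m, hm, h⟩ := mem_natName.1 h
      exact ⟨m, hm, by rw [(ZFSet.pair_injective h).1, ih m hm]⟩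
    · rintro ⟨m, hm, rfl⟩
      exact ⟨_, ∅, hG, mem_natName.2 ⟨m, hm, rfl⟩, ih m hm⟩

/-- The statement `p ∈ 2^{<ω}`, interpreted in a model. -/
def IsSegmentIn {M : Type*} (E : M → M → Prop) (o t p : M) : Prop :=
  ∃ n, E n o ∧ (∀ q, E q p → ∃ a i, E a n ∧ E i t ∧ IsPairIn E a i q) ∧
    ∀ a, E a n → ∃ i, PairMem E a i p ∧ ∀ j, PairMem E a j p → j = i

namespace IsCTM

variable {W : ZFSet.{u}}

theorem natName_mem (hW : IsCTM W) (n : ℕ) : natName n ∈ W := by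
  induction n with
  | zero => exact hW.empty_mem
  | succ n ih => exact hW.insert_mem (hW.pair_mem ih hW.empty_mem) ih

theorem isDefinable_natName (hW : IsCTM W) :
    IsDefinable (memOn W) (fun a : Fin 2 → {x // x ∈ W} =>
      ∃ n, a 0 = ⟨nat n, hW.nat_mem n⟩ ∧ a 1 = ⟨natName n, hW.natName_mem n⟩) := by
  refine isDefinable_sequence hW.zfc hW.isStandardOmega (fun n => ⟨natName n, hW.natName_mem n⟩)
    (R := fun w z => ∃ p, IsPairIn (memOn W) w ⟨∅, hW.empty_mem⟩ p ∧ IsInsertIn (memOn W) p w z)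
    inferInstance fun n y => ?_
  simp only [hW.isPairIn_iff, hW.isInsertIn_iff, Subtype.ext_iff, natName]
  constructor
  · rintro ⟨p, hp, h⟩
    rw [h, hp]
  · intro h
    exact ⟨⟨_, hW.pair_mem (hW.natName_mem n) hW.empty_mem⟩, rfl, h⟩

theorem isSegmentIn_iff (hW : IsCTM W) {p : {x // x ∈ W}} :
    IsSegmentIn (memOn W) ⟨ZFSet.omega, hW.omega_mem⟩ ⟨two, hW.two_mem⟩ p ↔
      p.1 ∈ cohenPoset := by
  rw [mem_cohenPoset_iff_isFunc]
  constructor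
  · rintro ⟨n, hn, hsub, hf⟩
    refine ⟨n.1, hn, fun q hq => ?_, fun a ha => ?_⟩
    · obtain ⟨a, i, ha, hi, h⟩ := hsub ⟨q, hW.mem_trans hq p.2⟩ hq
      rw [show q = _ from hW.isPairIn_iff.1 h]
      exact ZFSet.pair_mem_prod.2 ⟨ha, hi⟩
    · obtain ⟨i, hi, h⟩ := hf ⟨a, hW.mem_trans ha n.2⟩ ha
      refine ⟨i.1, hW.pairMem_iff.1 hi, fun j hj => ?_⟩
      -- Uniqueness in `W` speaks only about elements of `W`, so the competitor `j` must first be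
      -- placed there.
      have hj' : j ∈ W := by
        obtain ⟨q, hq, r, hr, e⟩ : ∃ q ∈ W, ∃ r ∈ W, ZFSet.pair a j = ZFSet.pair q r := by
          obtain ⟨q, r, -, -, h⟩ := hsub ⟨_, hW.mem_trans hj p.2⟩ hj
          exact ⟨q.1, q.2, r.1, r.2, hW.isPairIn_iff.1 h⟩
        rwa [(ZFSet.pair_injective e).2]
      exact congrArg Subtype.val (h ⟨j, hj'⟩ (hW.pairMem_iff.2 hj))
  · rintro ⟨n, hn, hsub, hf⟩
    refine ⟨⟨n, hW.mem_trans hn hW.omega_mem⟩, hn, fun q hq => ?_, fun a ha => ?_⟩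
    · obtain ⟨a, ha, i, hi, h⟩ := ZFSet.mem_prod.1 (hsub hq)
      exact ⟨⟨a, hW.mem_trans ha (hW.mem_trans hn hW.omega_mem)⟩, ⟨i, hW.mem_trans hi hW.two_mem⟩,
        ha, hi, hW.isPairIn_iff.2 h⟩
    · obtain ⟨i, hi, h⟩ := hf a.1 ha
      have hi' := hW.mem_trans (ZFSet.pair_mem_prod.1 (hsub hi)).2 hW.two_mem
      exact ⟨⟨i, hi'⟩, hW.pairMem_iff.2 hi,
        fun j hj => Subtype.ext (h j.1 (hW.pairMem_iff.1 hj))⟩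

/-- The bounding set from which separation in `W` cuts out the name of the Cohen real. -/
theorem exists_name_set (hW : IsCTM W) :
    ∃ A ∈ W, ∀ n, ∀ p ∈ cohenPoset, ZFSet.pair (natName n) p ∈ A := by
  obtain ⟨X, hX, hX'⟩ := hW.exists_pairs hW.omega_mem
  obtain ⟨Y, hY, hY'⟩ := hW.powerset_mem hX
  obtain ⟨C, hC⟩ := hW.zfc.exists_image (R := fun k σ =>
      ∃ n, k = ⟨nat n, hW.nat_mem n⟩ ∧ σ = ⟨natName n, hW.natName_mem n⟩)
    hW.isDefinable_natName (by
      rintro _ _ _ ⟨n, rfl, rfl⟩ ⟨m, h, rfl⟩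
      rw [hW.isStandardOmega.injective h]) ⟨ZFSet.omega, hW.omega_mem⟩
  obtain ⟨A, hA, hA'⟩ := hW.exists_pairs (hW.union_mem C.2 hY)
  refine ⟨A, hA, fun n p hp => hA' _ (ZFSet.mem_union.2 (.inl ?_)) _
    (ZFSet.mem_union.2 (.inr ?_))⟩
  · exact (hC ⟨_, hW.natName_mem n⟩).2
      ⟨⟨nat n, hW.nat_mem n⟩, mem_omega.2 ⟨n, rfl⟩, n, rfl, rfl⟩
  · obtain ⟨b, m, rfl⟩ := mem_cohenPoset.1 hp
    refine (hY' _).2 ⟨hW.segment_mem b m, fun q hq => ?_⟩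
    obtain ⟨k, -, rfl⟩ := mem_segment.1 hq
    -- The two bits are the natural numbers 0 and 1, so `X` already contains this pair.
    refine hX' _ (mem_omega.2 ⟨k, rfl⟩) _ (mem_omega.2 ?_)
    cases b k
    · exact ⟨0, rfl⟩
    · exact ⟨1, by simp [nat, bit]⟩

/-- Pairing the name of $n$ with every condition that takes the value 1 at $n$ yields a name for
$\{n : c(n)=1\}$. -/
theorem exists_cohen_name (hW : IsCTM W) :
    ∃ τ ∈ W, ∀ x, x ∈ τ ↔
      ∃ n, ∃ p ∈ cohenPoset, ZFSet.pair (nat n) (bit true) ∈ p ∧ x = ZFSet.pair (natName n) p := by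
  have hdef : ∀ {α : Type} (f g : (α → {x // x ∈ W}) → {x // x ∈ W}) [IsTerm f] [IsTerm g],
      IsDefinable (memOn W) (fun a =>
        ∃ n, f a = ⟨nat n, hW.nat_mem n⟩ ∧ g a = ⟨natName n, hW.natName_mem n⟩) :=
    fun f g => IsDefinable.subst_two (R := fun k σ =>
      ∃ n, k = ⟨nat n, hW.nat_mem n⟩ ∧ σ = ⟨natName n, hW.natName_mem n⟩)
      hW.isDefinable_natName f g
  obtain ⟨A, hA, hA'⟩ := hW.exists_name_set
  obtain ⟨τ, hτ, h⟩ := hW.sep_mem hA (R := fun x => ∃ k σ p,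
      (∃ n, k = ⟨nat n, hW.nat_mem n⟩ ∧ σ = ⟨natName n, hW.natName_mem n⟩) ∧
      IsSegmentIn (memOn W) ⟨ZFSet.omega, hW.omega_mem⟩ ⟨two, hW.two_mem⟩ p ∧
      PairMem (memOn W) k ⟨bit true, hW.bit_mem true⟩ p ∧ IsPairIn (memOn W) σ p x)
    (by unfold IsSegmentIn; infer_instance)
  refine ⟨τ, hτ, fun x => ?_⟩
  rw [h]
  simp only [hW.isSegmentIn_iff, hW.pairMem_iff, hW.isPairIn_iff]
  constructor
  · rintro ⟨-, -, _, _, p, ⟨n, rfl, rfl⟩, hp, hn, hx⟩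
    exact ⟨n, p.1, hp, hn, hx⟩
  · rintro ⟨n, p, hp, hn, rfl⟩
    obtain ⟨b, m, rfl⟩ := mem_cohenPoset.1 hp
    have hpW := hW.segment_mem b m
    exact ⟨hA' n _ hp, hW.pair_mem (hW.natName_mem n) hpW, _, _, ⟨_, hpW⟩,
      ⟨n, rfl, rfl⟩, hp, hn, rfl⟩

/-- The extension by a Cohen real contains a set whose natural numbers are the places at which the
real takes the value `1`. -/
theorem exists_mem_cohenExtension (hW : IsCTM W) (b : ℕ → Bool) :
    ∃ x ∈ cohenExtension W (real b), ∀ n, nat n ∈ x ↔ b n = true := by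
  obtain ⟨τ, hτ, h⟩ := hW.exists_cohen_name
  have hP : ∅ ∈ cohenPoset.{u} := segment_mem_cohenPoset b 0
  have hG : ∅ ∈ cohenFilter.{u} (real b) := mem_cohenFilter.2 ⟨0, rfl⟩
  refine ⟨_, ⟨τ, hτ, .mk _ (fun x hx => ?_) fun σ p hp => ?_, rfl⟩, fun n => ?_⟩
  · obtain ⟨n, p, hp, -, rfl⟩ := (h x).1 hx
    exact ⟨_, p, hp, rfl⟩
  · obtain ⟨n, p', -, -, e⟩ := (h _).1 hp
    rw [(ZFSet.pair_injective e).1]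
    exact isName_natName hP n
  · rw [mem_val]
    constructor
    · rintro ⟨σ, p, hp, hτ, hval⟩
      obtain ⟨m, p', -, hm, e⟩ := (h _).1 hτ
      obtain ⟨rfl, rfl⟩ := ZFSet.pair_injective e
      rw [val_natName hG] at hval
      obtain rfl := nat_injective hval
      obtain ⟨k, rfl⟩ := mem_cohenFilter.1 hp
      exact (pair_mem_segment.1 hm).2
    · intro hn
      -- Length `n + 1` is the least that decides the place `n`.
      exact ⟨natName n, segment b (n + 1), mem_cohenFilter.2 ⟨_, rfl⟩,
        (h _).2 ⟨n, _, segment_mem_cohenPoset b _, pair_mem_segment.2 ⟨by omega, hn⟩, rfl⟩,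
        val_natName hG n⟩

end IsCTM

/-! ### Coding a relation by a real -/

/-- An enumeration of the pairs of natural numbers along the diagonals. -/
def diagonal : ℕ → ℕ × ℕ
  | 0 => (0, 0)
  | n + 1 => match diagonal n with
    | (0, b) => (b + 1, 0)
    | (a + 1, b) => (a, b + 1)

/-- Induction on the diagonal $a+b=s$, then on $b$: $(a,b+1)$ comes right after $(a+1,b)$, and
$(s+1,0)$ right after $(0,s)$, the end of the previous diagonal. -/
theorem diagonal_surjective : Function.Surjective diagonal := by
  suffices h : ∀ s b a, a + b = s → ∃ k, diagonal k = (a, b) from fun p => h _ p.2 p.1 rfl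
  intro s
  induction s with
  | zero =>
    intro b a h
    obtain ⟨rfl, rfl⟩ : a = 0 ∧ b = 0 := by omega
    exact ⟨0, rfl⟩
  | succ s ih =>
    intro b
    induction b with
    | zero =>
      intro a h
      obtain ⟨k, hk⟩ := ih s 0 (by omega)
      exact ⟨k + 1, by simp only [diagonal, hk]; rw [← h]; rfl⟩
    | succ b ihb =>
      intro a h
      obtain ⟨k, hk⟩ := ihb (a + 1) (by omega)
      exact ⟨k + 1, by simp only [diagonal, hk]⟩

section Models

universe v

variable {M : Type v} {E : M → M → Prop} {N : ℕ → M} {o : M}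

/-- The internal definition of the successor along the diagonals. -/
def DiagonalStep (E : M → M → Prop) (x y : M) : Prop :=
  ∃ a b b', IsPairIn E a b x ∧ IsInsertIn E b b b' ∧
    ((∃ a', IsInsertIn E a' a' a ∧ IsPairIn E a' b' y) ∨ (IsEmptyIn E a ∧ IsPairIn E b' a y))

theorem diagonalStep_iff (H : IsModelZFC E) (S : IsStandardOmega E N o) {x : ℕ → M}
    (hx : ∀ n, IsPairIn E (N (diagonal n).1) (N (diagonal n).2) (x n)) (n : ℕ) (y : M) :
    DiagonalStep E (x n) y ↔ y = x (n + 1) := by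
  have h₀ := hx n
  have h₁ := hx (n + 1)
  rw [diagonal] at h₁
  constructor
  · rintro ⟨a, b, b', hp, hb, h⟩
    obtain ⟨rfl, rfl⟩ := H.pair_injective h₀ hp
    obtain rfl := S.eq_succ H hb
    rcases h with ⟨a', ha', hy⟩ | ⟨ha, hy⟩
    · obtain ⟨m, hm, rfl⟩ := S.eq_pred ha'
      rw [show diagonal n = (m + 1, (diagonal n).2) from Prod.ext hm rfl] at h₁
      exact H.pair_unique hy h₁
    · have ha := S.isEmptyIn_iff.1 ha
      rw [show diagonal n = (0, (diagonal n).2) from Prod.ext ha rfl] at h₁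
      rw [ha] at hy
      exact H.pair_unique hy h₁
  · rintro rfl
    refine ⟨_, _, _, h₀, S.isInsertIn_succ _, ?_⟩
    rcases hd : diagonal n with ⟨_ | a, b⟩
    · rw [hd] at h₁
      exact .inr ⟨S.isEmptyIn_iff.2 rfl, h₁⟩
    · rw [hd] at h₁
      exact .inl ⟨_, S.isInsertIn_succ a, h₁⟩

/-- A relation on the natural numbers is definable if its code along the diagonals is. -/
theorem isDefinable_of_code (H : IsModelZFC E) (S : IsStandardOmega E N o)
    (r : ℕ → ℕ → Prop) {Z : M → Prop} (hZ : IsDefinable E (fun a : Fin 1 → M => Z (a 0)))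
    (hr : ∀ k, Z (N k) ↔ r (diagonal k).1 (diagonal k).2) :
    IsDefinable E (fun a : Fin 2 → M => ∃ m n, a 0 = N m ∧ a 1 = N n ∧ r m n) := by
  -- The sequence is chosen outside the model; the recursion along `DiagonalStep` makes it definable
  -- inside.
  choose x hx using fun n => H.exists_pair (N (diagonal n).1) (N (diagonal n).2)
  have hx' := isDefinable_sequence H S x (R := DiagonalStep E)
    (by unfold DiagonalStep; infer_instance) (diagonalStep_iff H S hx)
  have hx'' : ∀ {α : Type} (f g : (α → M) → M) [IsTerm f] [IsTerm g],
      IsDefinable E (fun a => ∃ n, f a = N n ∧ g a = x n) :=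
    fun f g => IsDefinable.subst_two (R := fun k p => ∃ n, k = N n ∧ p = x n) hx' f g
  have hZ' : ∀ {α : Type} (f : (α → M) → M) [IsTerm f], IsDefinable E (fun a => Z (f a)) :=
    fun f hf => hZ.subst (fun _ => f) fun _ => hf
  have hdef : IsDefinable E (fun a : Fin 2 → M => ∃ k p, (∃ n, k = N n ∧ p = x n) ∧
    IsPairIn E (a 0) (a 1) p ∧ Z k) := inferInstance
  refine hdef.congr fun a => ⟨?_, ?_⟩
  · rintro ⟨_, _, ⟨k, rfl, rfl⟩, hp, hk⟩
    obtain ⟨h₁, h₂⟩ := H.pair_injective hp (hx k)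
    exact ⟨_, _, h₁, h₂, (hr k).1 hk⟩
  · rintro ⟨m, n, h₁, h₂, h⟩
    obtain ⟨k, hk⟩ := diagonal_surjective (m, n)
    refine ⟨_, _, ⟨k, rfl, rfl⟩, ?_, (hr k).2 (by rwa [hk])⟩
    rw [h₁, h₂]
    simpa only [hk] using hx k

theorem IsOrdIn.mem {x y : M} (hx : IsOrdIn E x) (hy : E y x) : IsOrdIn E y :=
  ⟨fun _ _ h₁ h₂ => hx.2 _ _ _ h₁ h₂ hy, fun _ _ w h₁ h₂ h₃ => hx.2 _ _ _ h₁ h₂ (hx.1 w y h₃ hy)⟩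

end Models

/-! ### Models with the ordinals of a countable transitive model -/

section SameOrdinals

variable {W U : ZFSet.{u}} {E : {x // x ∈ U} → {x // x ∈ U} → Prop}

/-- Only `y` has to be an ordinal: on either side, membership in `y` makes `x` an ordinal too, and
there the two orders agree. -/
theorem SameOrdinals.mem_iff (hW : IsCTM W) (hO : SameOrdinals E W) {x y : {x // x ∈ U}}
    (hy : IsOrdIn E y) : E x y ↔ x.1 ∈ y.1 := by
  refine ⟨fun h => (hO.2 x y (hy.mem h) hy).1 h, fun h => ?_⟩
  obtain ⟨hyW, hy'⟩ := (hO.1 y.1).1 ⟨y.2, hy⟩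
  obtain ⟨_, hx⟩ := (hO.1 x.1).2 ⟨hW.mem_trans h hyW, hy'.mem h⟩
  exact (hO.2 x y hx hy).2 h

theorem SameOrdinals.isOrdIn (hO : SameOrdinals E W) {x : {x // x ∈ U}} (hx : x.1 ∈ W)
    (hx' : x.1.IsOrdinal) : IsOrdIn E x :=
  ((hO.1 x.1).2 ⟨hx, hx'⟩).2

theorem SameOrdinals.nat_mem (hW : IsCTM W) (hO : SameOrdinals E W) (n : ℕ) : nat n ∈ U :=
  ((hO.1 _).2 ⟨hW.nat_mem n, isOrdinal_nat n⟩).1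

theorem SameOrdinals.omega_mem (hW : IsCTM W) (hO : SameOrdinals E W) : ZFSet.omega ∈ U :=
  ((hO.1 _).2 ⟨hW.omega_mem, isOrdinal_omega⟩).1

/-- The true $\omega$ and its elements are ordinals of `W`, hence of `U`, and below an ordinal `E`
is true membership. This holds even if `E` is ill-founded elsewhere. -/
theorem SameOrdinals.isStandardOmega (hW : IsCTM W) (hO : SameOrdinals E W) :
    IsStandardOmega E (fun n => ⟨nat n, hO.nat_mem hW n⟩) ⟨ZFSet.omega, hO.omega_mem hW⟩ where
  mem_omega x := by
    rw [hO.mem_iff hW (hO.isOrdIn hW.omega_mem isOrdinal_omega), mem_omega]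
    simp [Subtype.ext_iff]
  mem_nat x n := by
    rw [hO.mem_iff hW (hO.isOrdIn (hW.nat_mem n) (isOrdinal_nat n)), Nonamalgamation.mem_nat]
    simp [Subtype.ext_iff]
  injective m n h := nat_injective (congrArg Subtype.val h)

/-- A model of ZFC with the ordinals of `W` contains no code for an enumeration `g` of the ordinals
of `W` in order type `ω`. -/
theorem SameOrdinals.not_isDefinable_code (hW : IsCTM W) (H : IsModelZFC E)
    (hO : SameOrdinals E W) (g : ℕ → ZFSet.{u})
    (hg : ∀ x, (∃ n, x = g n) ↔ x ∈ W ∧ x.IsOrdinal) {Z : {x // x ∈ U} → Prop}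
    (hZ : IsDefinable E (fun a : Fin 1 → {x // x ∈ U} => Z (a 0))) :
    ¬ ∀ k, Z ⟨nat k, hO.nat_mem hW k⟩ ↔ g (diagonal k).1 ∈ g (diagonal k).2 := by
  intro hcode
  have S := hO.isStandardOmega hW
  have hdef := isDefinable_of_code H S (fun m n => g m ∈ g n) hZ hcode
  have hgW : ∀ n, g n ∈ W ∧ (g n).IsOrdinal := fun n => (hg _).1 ⟨n, rfl⟩
  have hgU : ∀ n, g n ∈ U := fun n => ((hO.1 _).2 (hgW n)).1
  have hgO : ∀ n, IsOrdIn E ⟨g n, hgU n⟩ := fun n => hO.isOrdIn (hgW n).1 (hgW n).2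
  have hOg : ∀ y : {x // x ∈ U}, IsOrdIn E y → ∃ n, y = ⟨g n, hgU n⟩ := by
    intro y hy
    obtain ⟨n, hn⟩ := (hg y.1).2 ((hO.1 y.1).1 ⟨y.2, hy⟩)
    exact ⟨n, Subtype.ext hn⟩
  set N : ℕ → {x // x ∈ U} := fun n => ⟨nat n, hO.nat_mem hW n⟩
  have hN : ∀ n, Function.invFun N (N n) = n := Function.leftInverse_invFun S.injective
  -- Extends `g` to all of `U`; its values off the natural numbers are junk and never matter.
  let G : {x // x ∈ U} → {x // x ∈ U} := fun k => ⟨g (Function.invFun N k), hgU _⟩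
  have hG : ∀ n, G (N n) = ⟨g n, hgU n⟩ := fun n => by simp only [G, hN]
  have hcol := isDefinable_collapse H ⟨ZFSet.omega, hO.omega_mem hW⟩
    (R := fun j k => ∃ m n, j = N m ∧ k = N n ∧ g m ∈ g n) hdef
    (by
      -- Well-foundedness comes from true membership, pulled back along `g`, and not from `E`.
      refine Subrelation.wf ?_ (InvImage.wf (fun k => g (Function.invFun N k)) ZFSet.mem_wf)
      rintro _ _ ⟨m, n, rfl, rfl, h⟩
      simpa only [InvImage, hN] using h)
    (by
      rintro _ _ _ ⟨i, j, rfl, rfl, hij⟩ ⟨j', k, h, rfl, hjk⟩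
      obtain rfl := S.injective h
      exact ⟨i, k, rfl, rfl, (hgW k).2.mem_trans hij hjk⟩)
    -- Every `E`-element of an ordinal is an ordinal, hence a value of `g`. So the collapse of the
    -- coded relation is `g` itself, even if `g` has repetitions.
    G (by
      intro k hk y
      obtain ⟨n, rfl⟩ := (S.mem_omega _).1 hk
      rw [hG]
      constructor
      · intro hy
        obtain ⟨m, rfl⟩ := hOg y ((hgO n).mem hy)
        exact ⟨N m, (S.mem_omega _).2 ⟨m, rfl⟩,
          ⟨m, n, rfl, rfl, (hO.mem_iff hW (hgO n)).1 hy⟩, (hG m).symm⟩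
      · rintro ⟨_, -, ⟨m, n', rfl, h, hmn⟩, rfl⟩
        obtain rfl := S.injective h
        rw [hG]
        exact (hO.mem_iff hW (hgO n)).2 hmn)
  -- The image of $\omega$ under `G` is a set of all ordinals of `U`; it is then an ordinal and an
  -- element of itself.
  obtain ⟨B, hB⟩ := H.exists_image
    (R := fun k y => E k ⟨ZFSet.omega, hO.omega_mem hW⟩ ∧ y = G k) hcol
    (by rintro k _ _ ⟨-, rfl⟩ ⟨-, rfl⟩; rfl) ⟨ZFSet.omega, hO.omega_mem hW⟩
  have hB' : ∀ y, E y B ↔ IsOrdIn E y := by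
    intro y
    rw [hB]
    constructor
    · rintro ⟨k, hk, -, rfl⟩
      exact hgO _
    · intro hy
      obtain ⟨n, rfl⟩ := hOg y hy
      have hn := (S.mem_omega (N n)).2 ⟨n, rfl⟩
      exact ⟨N n, hn, hn, (hG n).symm⟩
  have hBO : IsOrdIn E B :=
    ⟨fun y z h₁ h₂ => (hB' y).2 (((hB' z).1 h₂).mem h₁),
      fun y z w h₁ h₂ h₃ => ((hB' w).1 h₃).1 y z h₁ h₂⟩
  exact ZFSet.mem_irrefl _ ((hO.mem_iff hW hBO).1 ((hB' B).2 hBO))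

end SameOrdinals

/-! ### Assembling the proof -/

theorem exists_ordinal_enumeration {W : ZFSet.{u}} (hW : IsCTM W) :
    ∃ g : ℕ → ZFSet.{u}, ∀ x, (∃ n, x = g n) ↔ x ∈ W ∧ x.IsOrdinal := by
  have hc : {x : ZFSet.{u} | x ∈ W ∧ x.IsOrdinal}.Countable :=
    hW.countable.mono fun x hx => hx.1
  obtain ⟨g, hg⟩ := hc.exists_eq_range ⟨∅, hW.nat_mem 0, isOrdinal_nat 0⟩
  exact ⟨g, fun x => ((Set.ext_iff.1 hg x).trans (exists_congr fun _ => eq_comm)).symm⟩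

theorem nat_mem_cohenExtension {W : ZFSet.{u}} (hW : IsCTM W) (b : ℕ → Bool) (n : ℕ) :
    nat n ∈ cohenExtension W (real b) :=
  ⟨natName n, hW.natName_mem n, isName_natName (segment_mem_cohenPoset b 0) n,
    val_natName (mem_cohenFilter.2 ⟨0, rfl⟩) n⟩

end Nonamalgamation

theorem mainTheorem3 (W : ZFSet.{u}) (hW : Nonamalgamation.IsCTM W) :
    ∃ c d : ZFSet.{u},
      Nonamalgamation.IsCohenReal W c ∧ Nonamalgamation.IsCohenReal W d ∧
      ¬ ∃ (U : ZFSet.{u}) (E : {x // x ∈ U} → {x // x ∈ U} → Prop),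
          Nonamalgamation.IsModelZFC E ∧
          Nonamalgamation.Extends E (Nonamalgamation.cohenExtension W c) ∧
          Nonamalgamation.Extends E (Nonamalgamation.cohenExtension W d) ∧
          Nonamalgamation.SameOrdinals E W := by
  classical
  open Nonamalgamation in
  obtain ⟨g, hg⟩ := exists_ordinal_enumeration hW
  let z : ℕ → Bool := fun k => decide (g (diagonal k).1 ∈ g (diagonal k).2)
  obtain ⟨b, hb, hb'⟩ := exists_isCohenReal_xor hW.countable z
  refine ⟨_, _, hb, hb', ?_⟩
  rintro ⟨U, E, H, hc, hd, hO⟩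
  obtain ⟨x, hx, hxb⟩ := hW.exists_mem_cohenExtension b
  obtain ⟨y, hy, hyb⟩ := hW.exists_mem_cohenExtension fun n => xor (b n) (z n)
  -- The code is recovered in `U` as the set of places where the two reals differ. The numbers `nat
  -- k` lie in both extensions, so `E` reads both reals correctly.
  refine hO.not_isDefinable_code hW H g hg
    (Z := fun k => ¬ (E k ⟨x, hc.1 x hx⟩ ↔ E k ⟨y, hd.1 y hy⟩)) inferInstance fun k => ?_
  rw [hc.2 _ _ (nat_mem_cohenExtension hW b k) hx,
    hd.2 _ _ (nat_mem_cohenExtension hW _ k) hy, hxb, hyb,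
    show g (diagonal k).1 ∈ g (diagonal k).2 ↔ z k = true from decide_eq_true_iff.symm]
  cases b k <;> cases z k <;> simp
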